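/- Fix $T>0$, a probability space $(\Omega,\mathcal A,\mathbb P)$, right-continuous filtrations $\mathbb F=(\mathcal F_t)_{t\in[0,T]}$ and $\mathbb G=(\mathcal G_t)_{t\in[0,T]}$, and finite sets $S_1,\dots,S_N$; put $S=S_1\times\dots\times S_N$. For a process $U$, $\mathbb F^U$ denotes the completed right-continuous filtration on $[0,T]$ generated by $U$. Definitions. For a finite set $E$, an $E$-valued càdlàg process $Z$ adapted to a filtration $\mathbb H$ is * an $(\mathbb F,\mathbb H)$-CMC if for all $0\le t\le t_1\le\dots\le t_n\le T$ and $z_1,\dots,z_n\in E$, a.s. $\mathbb P(Z_{t_1}=z_1,\dots,Z_{t_n}=z_n\mid\mathcal F_t\vee\mathcal H_t)=\mathbb P(Z_{t_1}=z_1,\dots,Z_{t_n}=z_n\mid\mathcal F_t\vee\sigma(Z_t))$; * an $(\mathbb F,\mathbb H)$-DSMC if for all $0\le s\le t\le T$ and $y\in E$, a.s. $\mathbb P(Z_t=y\mid\mathcal F_T\vee\mathcal H_s)=\mathbb P(Z_t=y\mid\mathcal F_t\vee\sigma(Z_s))$. An *intensity process* on $E$ is an $\mathbb F$-progressively measurable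 process $\Gamma=[\gamma^{xy}_t]_{x,y\in E}$ such that, a.s., $\gamma^{xy}_t\ge 0$ for $x\ne y$ and $\sum_y\gamma^{xy}_t=0$ for all $t\in[0,T]$, and $\int_0^T\sum_x|\gamma^{xx}_u|\,du<\infty$. An $(\mathbb F,\mathbb H)$-DSMC $Z$ *has intensity* $\Gamma$ if $\Gamma$ is an intensity process and there are $\mathcal F_t$-measurable, a.s. stochastic matrices $P(s,t)=[p_{xy}(s,t)]$, $0\le s\le t\le T$, with $\mathbb P(Z_t=y\mid\mathcal F_T\vee\mathcal H_s)=\sum_x\mathbf 1_{\{Z_s=x\}}p_{xy}(s,t)$ a.s., such that a.s., for all $0\le v\le t\le T$, $P(v,t)-I=\int_v^t\Gamma_uP(u,t)\,du$ and $P(v,t)-I=\int_v^tP(v,u)\Gamma_u\,du$. An $(\mathbb F,\mathbb H)$-CDMC with intensity $\Gamma$ is an $(\mathbb F,\mathbb H)$-CMC which is also an $(\mathbb F,\mathbb H)$-DSMC with intensity $\Gamma$. Statement. Let $\Psi^k$ be an intensity process on $S_k$, $k=1,\dots,N$, and let $$\Lambda_t=\sum_{k=1}^N I_1\otimes\dots\otimes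 I_{k-1}\otimes\Psi^k_t\otimes I_{k+1}\otimes\dots\otimes I_N .$$ Let $X=(X^1,\dots,X^N)$ be an $S$-valued $(\mathbb F,\mathbb G)$-DSMC with intensity $\Lambda$ (for instance, an $(\mathbb F,\mathbb F^X)$-CDMC with intensity $\Lambda$) such that, a.s., for all $x\in S$, $$\mathbb P(X_0=x\mid\mathcal F_T)=\prod_{k=1}^N\mathbb P(X^k_0=x^k\mid\mathcal F_T).$$ (a) The components $X^1,\dots,X^N$ (that is, the sigma-algebras $\sigma(X^k_t:t\in[0,T])$) are conditionally independent given $\mathcal F_T$. (b) Let $\mathbb Q$ be a probability measure on $(\Omega,\mathcal A)$ with $\mathbb P\ll\mathbb Q$ on $\mathcal F_T$. Let $Y^1,\dots,Y^N$ be such that, under $\mathbb Q$, $Y^k$ is an $(\mathbb F,\mathbb F^{Y^k})$-CDMC with values in $S_k$ and intensity $\Psi^k$. Assume that $\mathbb Q(Y^k_0=x^k\mid\mathcal F_T)=\mathbb Q(Y^k_0=x^k\mid\mathcal F_0)$ $\mathbb Q$-a.s. and $\mathbb P(X^k_0=x^k\mid\mathcal F_T)=\mathbb Q(Y^k_0=x^k\mid\mathcal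 F_T)$ $\mathbb P$-a.s., for all $k$ and $x^k\in S_k$. Then $X$ is a strong CMC copula between $Y^1,\dots,Y^N$: under $\mathbb P$, $X$ and every $X^k$ are $(\mathbb F,\mathbb F^X)$-CMCs, and for every $k$ the conditional law given $\mathcal F_T$ of the path of $X^k$ under $\mathbb P$ coincides ($\mathbb P$-a.s.) with that of $Y^k$ under $\mathbb Q$. Moreover, under $\mathbb P$, $X$ is an $(\mathbb F,\mathbb F^X)$-CDMC with intensity $\Lambda$, and every $X^k$ is an $(\mathbb F,\mathbb F^X)$-CDMC with intensity $\Psi^k$. By (a), $X$ is thus a conditionally independent strong CMC copula. -/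

import Mathlib

open MeasureTheory ProbabilityTheory Set Filter
open scoped Topology

noncomputable section

namespace CondMarkov

variable {Ω : Type*} [mΩ : MeasurableSpace Ω] {S : Type*}

/-! ### Processes on the time interval `[0, T]`

A process is a map `X : ℝ → Ω → S` of which only the values at times in `[0, T]` are ever used.
The state spaces are finite and carry the discrete sigma-algebra. -/

/-- The sigma-algebra `σ(X_t)`. -/
@[reducible] def stateSigma [MeasurableSpace S] (X : ℝ → Ω → S) (t : ℝ) : MeasurableSpace Ω :=
  MeasurableSpace.comap (X t) inferInstance

/-- The history of `X` up to time `t`, that is `σ(X_s : 0 ≤ s ≤ t)`. -/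
@[reducible] def history [MeasurableSpace S] (X : ℝ → Ω → S) (t : ℝ) : MeasurableSpace Ω :=
  ⨆ s ∈ Icc (0 : ℝ) t, stateSigma X s

/-- The filtration `𝔽^X` on `[0, T]` generated by `X`, made right-continuous and completed with the
`P`-null sets. -/
@[reducible] def generatedFiltration [MeasurableSpace S] (T : ℝ) (P : Measure Ω) (X : ℝ → Ω → S)
    (t : ℝ) : MeasurableSpace Ω :=
  (⨅ u ∈ Ioi t, history X (min u T)) ⊔
    MeasurableSpace.generateFrom {A : Set Ω | MeasurableSet A ∧ P A = 0}

/-- Right-continuity of a filtration on the time interval `[0, T]`. -/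
def IsRightContinuousOn (T : ℝ) (𝓖 : Filtration ℝ mΩ) : Prop :=
  ∀ t ∈ Ico (0 : ℝ) T, ⨅ u ∈ Ioc t T, 𝓖 u ≤ 𝓖 t

/-- All paths on `[0, T]` are right-continuous with left limits (for the discrete topology of the
finite state space: locally constant to the right, and eventually constant from the left). -/
def IsCadlagOn (T : ℝ) (X : ℝ → Ω → S) : Prop :=
  ∀ ω, (∀ t ∈ Ico (0 : ℝ) T, ∀ᶠ u in 𝓝[>] t, X u ω = X t ω) ∧
    ∀ t ∈ Ioc (0 : ℝ) T, ∃ x : S, ∀ᶠ u in 𝓝[<] t, X u ω = x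

/-- `X` is a cadlag process on `[0, T]` adapted to the family `𝓖` of sub-sigma-algebras. -/
structure IsAdaptedCadlag [MeasurableSpace S] (T : ℝ) (𝓖 : ℝ → MeasurableSpace Ω)
    (X : ℝ → Ω → S) : Prop where
  le : ∀ t ∈ Icc (0 : ℝ) T, 𝓖 t ≤ mΩ
  adapted : ∀ t ∈ Icc (0 : ℝ) T, Measurable[𝓖 t] (X t)
  cadlag : IsCadlagOn T X

/-- `X` is an `(𝓕, 𝓖)`-conditional Markov chain under `P`. -/
structure IsCMC [MeasurableSpace S] (𝓕 : Filtration ℝ mΩ) (𝓖 : ℝ → MeasurableSpace Ω) (T : ℝ)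
    (P : Measure Ω) (X : ℝ → Ω → S) : Prop where
  process : IsAdaptedCadlag T 𝓖 X
  markov : ∀ (n : ℕ) (t : ℝ) (τ : Fin n → ℝ) (x : Fin n → S),
    0 ≤ t → t ≤ T → Monotone τ → (∀ i, t ≤ τ i ∧ τ i ≤ T) →
      P⟦{ω | ∀ i, X (τ i) ω = x i} | 𝓕 t ⊔ 𝓖 t⟧ =ᵐ[P]
        P⟦{ω | ∀ i, X (τ i) ω = x i} | 𝓕 t ⊔ stateSigma X t⟧

/-- `X` is an `(𝓕, 𝓖)`-doubly stochastic Markov chain under `P`. -/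
structure IsDSMC [MeasurableSpace S] (𝓕 : Filtration ℝ mΩ) (𝓖 : ℝ → MeasurableSpace Ω) (T : ℝ)
    (P : Measure Ω) (X : ℝ → Ω → S) : Prop where
  process : IsAdaptedCadlag T 𝓖 X
  markov : ∀ (s t : ℝ) (y : S), 0 ≤ s → s ≤ t → t ≤ T →
    P⟦{ω | X t ω = y} | 𝓕 T ⊔ 𝓖 s⟧ =ᵐ[P] P⟦{ω | X t ω = y} | 𝓕 t ⊔ stateSigma X s⟧

section Intensity

variable [Fintype S]

/-- `p` is (a version of) the conditional transition probability matrix field of `X`: the matrices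
`p(s,t)` are `𝓕_t`-measurable, stochastic, and
`P(X_t = y | 𝓕_T ∨ 𝓖_s) = ∑_x 1_{X_s = x} p_{xy}(s,t)`. On rows `x` with `P(X_s = x | 𝓕_t) = 0` the
field is not determined by `X`, and no normalisation is imposed there. -/
structure IsCTransitionField [MeasurableSpace S] (𝓕 : Filtration ℝ mΩ)
    (𝓖 : ℝ → MeasurableSpace Ω) (T : ℝ) (P : Measure Ω) (X : ℝ → Ω → S)
    (p : ℝ → ℝ → Ω → Matrix S S ℝ) : Prop where
  measurable : ∀ s t, 0 ≤ s → s ≤ t → t ≤ T → ∀ x y, Measurable[𝓕 t] fun ω => p s t ω x y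
  stochastic : ∀ s t, 0 ≤ s → s ≤ t → t ≤ T →
    ∀ᵐ ω ∂P, (∀ x y, 0 ≤ p s t ω x y) ∧ ∀ x, ∑ y, p s t ω x y = 1
  transition : ∀ s t, 0 ≤ s → s ≤ t → t ≤ T → ∀ y,
    P⟦{ω | X t ω = y} | 𝓕 T ⊔ 𝓖 s⟧ =ᵐ[P] fun ω => p s t ω (X s ω) y

/-- `Γ` is an `𝓕`-progressively measurable process of intensity matrices (nonnegative off-diagonal
entries, zero row sums) with `∫_0^T ∑_x |γ^{xx}_u| du < ∞`, `P`-almost surely. -/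
structure IsIntensityProcess (𝓕 : Filtration ℝ mΩ) (T : ℝ) (P : Measure Ω)
    (Γ : ℝ → Ω → Matrix S S ℝ) : Prop where
  progMeasurable : ∀ t ∈ Icc (0 : ℝ) T, ∀ x y,
    Measurable[MeasurableSpace.prod (inferInstance : MeasurableSpace (Icc (0 : ℝ) t)) (𝓕 t)]
      fun q : Icc (0 : ℝ) t × Ω => Γ q.1 q.2 x y
  nonneg : ∀ᵐ ω ∂P, ∀ u ∈ Icc (0 : ℝ) T, ∀ x y, x ≠ y → 0 ≤ Γ u ω x y
  row_sum : ∀ᵐ ω ∂P, ∀ u ∈ Icc (0 : ℝ) T, ∀ x, ∑ y, Γ u ω x y = 0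
  integrable : ∀ᵐ ω ∂P, ∀ x, IntervalIntegrable (fun u => Γ u ω x x) volume 0 T

/-- The Kolmogorov backward and forward equations on `[0, T]` for a two-parameter family `p` of
matrices and a (deterministic) rate function `γ`, entry by entry. -/
def SolvesKolmogorov [DecidableEq S] (T : ℝ) (γ : ℝ → Matrix S S ℝ)
    (p : ℝ → ℝ → Matrix S S ℝ) : Prop :=
  ∀ v t, 0 ≤ v → v ≤ t → t ≤ T → ∀ x y,
    (IntervalIntegrable (fun u => (γ u * p u t) x y) volume v t ∧
      (p v t - 1) x y = ∫ u in v..t, (γ u * p u t) x y) ∧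
    (IntervalIntegrable (fun u => (p v u * γ u) x y) volume v t ∧
      (p v t - 1) x y = ∫ u in v..t, (p v u * γ u) x y)

/-- `X` is an `(𝓕, 𝓖)`-doubly stochastic Markov chain with intensity `Γ` under `P`. -/
structure IsDSMCWithIntensity [DecidableEq S] [MeasurableSpace S] (𝓕 : Filtration ℝ mΩ)
    (𝓖 : ℝ → MeasurableSpace Ω) (T : ℝ) (P : Measure Ω) (X : ℝ → Ω → S)
    (Γ : ℝ → Ω → Matrix S S ℝ) : Prop where
  dsmc : IsDSMC 𝓕 𝓖 T P X
  intensity : IsIntensityProcess 𝓕 T P Γ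
  kolmogorov : ∃ p : ℝ → ℝ → Ω → Matrix S S ℝ, IsCTransitionField 𝓕 𝓖 T P X p ∧
    ∀ᵐ ω ∂P, SolvesKolmogorov T (fun u => Γ u ω) (fun s t => p s t ω)

/-- `X` is an `(𝓕, 𝓖)`-CDMC with intensity `Γ` under `P`: both an `(𝓕, 𝓖)`-conditional Markov chain
and an `(𝓕, 𝓖)`-doubly stochastic Markov chain with intensity `Γ`. -/
def IsCDMC [DecidableEq S] [MeasurableSpace S] (𝓕 : Filtration ℝ mΩ)
    (𝓖 : ℝ → MeasurableSpace Ω) (T : ℝ) (P : Measure Ω) (X : ℝ → Ω → S)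
    (Γ : ℝ → Ω → Matrix S S ℝ) : Prop :=
  IsCMC 𝓕 𝓖 T P X ∧ IsDSMCWithIntensity 𝓕 𝓖 T P X Γ

end Intensity

/-! ### Multivariate processes -/

/-- The `k`-th component of a multivariate process. -/
def component {N : ℕ} {S : Fin N → Type*} (X : ℝ → Ω → ∀ k, S k) (k : Fin N) : ℝ → Ω → S k :=
  fun t ω => X t ω k

/-- The Kronecker product `A₁ ⊗ ⋯ ⊗ A_N`, indexed by the product set. -/
def kroneckerProd {N : ℕ} {S : Fin N → Type*} (A : ∀ k, Matrix (S k) (S k) ℝ) :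
    Matrix (∀ k, S k) (∀ k, S k) ℝ :=
  Matrix.of fun x y => ∏ k, A k (x k) (y k)

/-- The Kronecker sum `∑_k I₁ ⊗ ⋯ ⊗ I_{k-1} ⊗ A_k ⊗ I_{k+1} ⊗ ⋯ ⊗ I_N`. -/
def kroneckerSum {N : ℕ} {S : Fin N → Type*} [∀ k, DecidableEq (S k)]
    (A : ∀ k, Matrix (S k) (S k) ℝ) : Matrix (∀ k, S k) (∀ k, S k) ℝ :=
  ∑ k, kroneckerProd (Function.update (fun j => (1 : Matrix (S j) (S j) ℝ)) k (A k))

/-- The sub-sigma-algebras `m i` are conditionally independent given `m'` under `P`. (This is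
Mathlib's `iCondIndep`, written without regular conditional probabilities, so that no topological
assumption on `Ω` is needed.) -/
def CondIndepGiven {ι : Type*} (P : Measure Ω) (m' : MeasurableSpace Ω)
    (m : ι → MeasurableSpace Ω) : Prop :=
  ∀ (s : Finset ι) (A : ι → Set Ω), (∀ i ∈ s, MeasurableSet[m i] (A i)) →
    P⟦⋂ i ∈ s, A i | m'⟧ =ᵐ[P] ∏ i ∈ s, P⟦A i | m'⟧

/-- The conditional law given `m'` of the path `(X_t)_{t ∈ [0,T]}` under `P` coincides with the
conditional law given `m'` of the path `(Y_t)_{t ∈ [0,T]}` under `Q`. -/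
def SameCondLaw [MeasurableSpace S] (T : ℝ) (P Q : Measure Ω) (m' : MeasurableSpace Ω)
    (X Y : ℝ → Ω → S) : Prop :=
  ∀ B : Set (Icc (0 : ℝ) T → S), MeasurableSet B →
    P⟦{ω | (fun t : Icc (0 : ℝ) T => X t ω) ∈ B} | m'⟧ =ᵐ[P]
      Q⟦{ω | (fun t : Icc (0 : ℝ) T => Y t ω) ∈ B} | m'⟧

/-- `X` under `P` is a strong CMC copula between `Y¹, …, Y^N` (which live under `Q`): the `Y^k` are
`(𝓕, 𝓕^{Y^k})`-CMCs, `X` is an `(𝓕, 𝓕^X)`-CMC, every component `X^k` is an `(𝓕, 𝓕^X)`-CMC (strong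
Markovian consistency), and the conditional laws of `X^k` and `Y^k` given `𝓕_T` coincide. -/
structure IsStrongCMCCopula {N : ℕ} {S : Fin N → Type*} [∀ k, MeasurableSpace (S k)]
    (𝓕 : Filtration ℝ mΩ) (T : ℝ) (P Q : Measure Ω) (X : ℝ → Ω → ∀ k, S k)
    (Y : ∀ k, ℝ → Ω → S k) : Prop where
  marginals : ∀ k, IsCMC 𝓕 (generatedFiltration T Q (Y k)) T Q (Y k)
  cmc : IsCMC 𝓕 (generatedFiltration T P X) T P X
  consistent : ∀ k, IsCMC 𝓕 (generatedFiltration T P X) T P (component X k)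
  law : ∀ k, SameCondLaw T P Q (𝓕 T) (component X k) (Y k)

end CondMarkov

end

noncomputable section

namespace CondMarkov

/-! ### Linear integral equations with integrable coefficients -/

section Forward

/-! For almost every ω the transition matrices `p` of the chain solve linear integral equations with
integrable coefficients. The forward equation has at most one solution, because the Picard iterates
converge to any given solution (`SolvesForward.tendsto_picard`). Summing the forward equation of a
Kronecker sum over all coordinates but the k-th gives the forward equation of the k-th summand,
since the other summands have zero row sums. By uniqueness this marginal depends on the starting
point only through its k-th coordinate. By the Leibniz rule, the product of the marginals solves the
equation of the Kronecker sum, so uniqueness gives that `p` is the Kronecker product of its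
marginals (`SolvesKolmogorov.eq_prod_marginalMatrix`). No existence theorem is needed: the marginals
of `p` are the required marginal solutions.

Given `𝓕 T`, the transition matrices are known, so finite-dimensional conditional laws are sums over
paths of products of transition probabilities, weighted by the initial law
(`IsCTransitionField.condExp_prod_terminal`). If the matrices and the initial law both factorise, so
do these sums. A π-λ argument then yields conditional independence of the components
(`condIndepGiven_history`).

For the copula, the marginals of `p` and the transition matrices of the k-th target process solve
the same equation, one under `P` and the other under `Q`. The Picard iterates are `𝓕 T`-measurable,
so the identification survives although the measures are compared only on `𝓕 T`
(`ae_eq_of_solvesKolmogorov`). Equal initial laws then give equal path laws.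

The Markov property relative to `𝓕 t` needs an immersion property: the conditional probability given
`𝓕 T` of an event of the past up to `t` is `𝓕 t`-measurable. It holds because the initial law given
`𝓕 T` is a product of `𝓕 0`-measurable factors and the transition matrices up to `t` are `𝓕
t`-measurable; right-continuity of `𝓕` carries it to the completed right-continuous filtration. Then
the past does not help to predict `𝓕 T`, and `IsCTransitionField.isCMC` applies to the chain and its
components alike. -/

theorem absolutelyContinuousOnInterval_const (c a b : ℝ) :
    AbsolutelyContinuousOnInterval (fun _ : ℝ => c) a b :=
  (LipschitzWith.const c).lipschitzOnWith.absolutelyContinuousOnInterval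

theorem absolutelyContinuousOnInterval_prod {ι : Type*} (s : Finset ι) {f : ι → ℝ → ℝ} {a b : ℝ}
    (h : ∀ i ∈ s, AbsolutelyContinuousOnInterval (f i) a b) :
    AbsolutelyContinuousOnInterval (fun u => ∏ i ∈ s, f i u) a b := by
  classical
  induction s using Finset.induction_on with
  | empty => simpa using absolutelyContinuousOnInterval_const 1 a b
  | insert i s hi ih =>
    simp only [Finset.prod_insert hi]
    exact (h i (Finset.mem_insert_self i s)).fun_mul
      (ih fun j hj => h j (Finset.mem_insert_of_mem hj))

variable {S : Type*} [Fintype S]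

/-- The row vector `q` solves the forward equation `q_t = c + ∫_a^t q_u γ_u du` on `[a, b]`. -/
def SolvesForward (a b : ℝ) (γ : ℝ → Matrix S S ℝ) (c : S → ℝ) (q : ℝ → S → ℝ) : Prop :=
  ∀ t ∈ Icc a b, ∀ y, IntervalIntegrable (fun u => ∑ z, q u z * γ u z y) volume a t ∧
    q t y = c y + ∫ u in a..t, ∑ z, q u z * γ u z y

/-- The Picard iterates of the forward equation. -/
def picard (a : ℝ) (γ : ℝ → Matrix S S ℝ) (c : S → ℝ) : ℕ → ℝ → S → ℝ
  | 0, _ => c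
  | n + 1, t => fun y => c y + ∫ u in a..t, ∑ z, picard a γ c n u z * γ u z y

theorem intervalIntegrable_fun_sum {ι : Type*} (s : Finset ι) {f : ι → ℝ → ℝ} {a b : ℝ}
    (h : ∀ i ∈ s, IntervalIntegrable (f i) volume a b) :
    IntervalIntegrable (fun u => ∑ i ∈ s, f i u) volume a b := by
  rw [show (fun u => ∑ i ∈ s, f i u) = ∑ i ∈ s, f i from (Finset.sum_fn s f).symm]
  exact IntervalIntegrable.sum s h

/-- Powers of the primitive are absolutely continuous, so the fundamental theorem of calculus holds
although `f` is merely integrable. This is the source of the factorials in the Picard estimate. -/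
theorem integral_mul_primitive_pow {f : ℝ → ℝ} {a t : ℝ} (hf : IntervalIntegrable f volume a t)
    (n : ℕ) :
    ∫ u in a..t, f u * (∫ r in a..u, f r) ^ n = (∫ u in a..t, f u) ^ (n + 1) / (n + 1) := by
  set F : ℝ → ℝ := fun u => ∫ r in a..u, f r with hF
  have hac : AbsolutelyContinuousOnInterval F a t :=
    hf.absolutelyContinuousOnInterval_intervalIntegral left_mem_uIcc
  have hpow : ∀ m : ℕ, AbsolutelyContinuousOnInterval (fun u => F u ^ (m + 1)) a t := by
    intro m
    induction m with
    | zero => simpa using hac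
    | succ m ih => simpa only [pow_succ _ (m + 1)] using ih.fun_mul hac
  have hn : (n + 1 : ℝ) ≠ 0 := by positivity
  have h1 := (hpow n).integral_deriv_eq_sub
  have h2 : ∫ u in a..t, deriv (fun u => F u ^ (n + 1)) u
      = ∫ u in a..t, (n + 1 : ℝ) * (f u * F u ^ n) := by
    apply intervalIntegral.integral_congr_ae
    filter_upwards [hf.ae_hasDerivAt_integral] with u hu hut
    have h3 := (hu (uIoc_subset_uIcc hut) a left_mem_uIcc).pow (n + 1)
    rw [show (fun u => F u ^ (n + 1)) = (fun x => ∫ (t : ℝ) in a..x, f t) ^ (n + 1) from rfl,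
      h3.deriv]
    simp only [add_tsub_cancel_right, hF]
    push_cast
    ring
  rw [h2, intervalIntegral.integral_const_mul] at h1
  have h4 : F a = 0 := by simp [hF]
  rw [h4, zero_pow (by omega), sub_zero] at h1
  rw [eq_div_iff hn, mul_comm]
  exact h1

theorem intervalIntegrable_sum_mul {a b : ℝ} {γ : ℝ → Matrix S S ℝ} {q : ℝ → S → ℝ}
    (hγ : ∀ x y, IntervalIntegrable (fun u => γ u x y) volume a b)
    (hq : ∀ z, ContinuousOn (fun u => q u z) (Icc a b)) {t : ℝ} (ht : t ∈ Icc a b) (y : S) :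
    IntervalIntegrable (fun u => ∑ z, q u z * γ u z y) volume a t := by
  have hsub : uIcc a t ⊆ Icc a b := by
    rw [uIcc_of_le ht.1]; exact Icc_subset_Icc_right ht.2
  refine intervalIntegrable_fun_sum _ fun z _ => ?_
  exact IntervalIntegrable.continuousOn_mul ((hγ z y).mono_set
    (by rwa [uIcc_of_le (ht.1.trans ht.2)])) ((hq z).mono hsub)

theorem SolvesForward.continuousOn {a b : ℝ} {γ : ℝ → Matrix S S ℝ} {c : S → ℝ}
    {q : ℝ → S → ℝ} (h : SolvesForward a b γ c q) (y : S) :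
    ContinuousOn (fun u => q u y) (Icc a b) := by
  by_cases hab : a ≤ b
  · have h1 := (h b ⟨hab, le_rfl⟩ y).1
    have h2 := intervalIntegral.continuousOn_primitive_interval' h1 left_mem_uIcc
    rw [uIcc_of_le hab] at h2
    exact (continuousOn_const.add h2).congr fun t ht => (h t ht y).2
  · rw [Icc_eq_empty hab]; exact continuousOn_empty _

theorem continuousOn_picard {a b : ℝ} (hab : a ≤ b) {γ : ℝ → Matrix S S ℝ} (c : S → ℝ)
    (hγ : ∀ x y, IntervalIntegrable (fun u => γ u x y) volume a b) (n : ℕ) (y : S) :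
    ContinuousOn (fun u => picard a γ c n u y) (Icc a b) := by
  induction n generalizing y with
  | zero => exact continuousOn_const
  | succ n ih =>
    have h2 := intervalIntegral.continuousOn_primitive_interval'
      (intervalIntegrable_sum_mul hγ ih (right_mem_Icc.2 hab) y) left_mem_uIcc
    rw [uIcc_of_le hab] at h2
    exact continuousOn_const.add h2

/-- Each iteration integrates the previous error against the sum of all `|γ u x y|`. Comparing with
a solution that is already given, rather than with the next iterate, makes a separate existence
proof unnecessary. -/
theorem SolvesForward.sum_abs_sub_picard_le {a b : ℝ} {γ : ℝ → Matrix S S ℝ} {c : S → ℝ}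
    {q : ℝ → S → ℝ} (h : SolvesForward a b γ c q)
    (hγ : ∀ x y, IntervalIntegrable (fun u => γ u x y) volume a b) {M : ℝ}
    (hM : ∀ t ∈ Icc a b, ∑ y, |q t y - c y| ≤ M) (n : ℕ) :
    ∀ t ∈ Icc a b, ∑ y, |q t y - picard a γ c n t y|
      ≤ M * ((∫ u in a..t, ∑ x, ∑ y, |γ u x y|) ^ n / n.factorial) := by
  set g : ℝ → ℝ := fun u => ∑ x, ∑ y, |γ u x y| with hg
  have hgi : IntervalIntegrable g volume a b :=
    intervalIntegrable_fun_sum _ fun x _ => intervalIntegrable_fun_sum _ fun y _ => (hγ x y).abs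
  induction n with
  | zero => intro t ht; simpa [picard] using hM t ht
  | succ n ih =>
    intro t ht
    have hab : a ≤ b := ht.1.trans ht.2
    have hgit : IntervalIntegrable g volume a t := hgi.mono_set (by
      rw [uIcc_of_le ht.1, uIcc_of_le hab]; exact Icc_subset_Icc_right ht.2)
    have hJ := continuousOn_picard hab c hγ n
    have hd : ∀ z, ContinuousOn (fun u => (q u z - picard a γ c n u z)) (Icc a b) :=
      fun z => (h.continuousOn z).sub (hJ z)
    have hdi : ∀ y, IntervalIntegrable
        (fun u => ∑ z, (q u z - picard a γ c n u z) * γ u z y) volume a t :=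
      fun y => intervalIntegrable_sum_mul hγ hd ht y
    have hdiff : ∀ y, q t y - picard a γ c (n + 1) t y
        = ∫ u in a..t, ∑ z, (q u z - picard a γ c n u z) * γ u z y := by
      intro y
      rw [(h t ht y).2, picard, add_sub_add_left_eq_sub, ← intervalIntegral.integral_sub
        (h t ht y).1 (intervalIntegrable_sum_mul hγ hJ ht y)]
      simp only [sub_mul, Finset.sum_sub_distrib]
    have hFc : ContinuousOn (fun u => ∫ r in a..u, g r) (uIcc a t) :=
      intervalIntegral.continuousOn_primitive_interval' hgit left_mem_uIcc
    calc ∑ y, |q t y - picard a γ c (n + 1) t y|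
        ≤ ∑ y, ∫ u in a..t, |∑ z, (q u z - picard a γ c n u z) * γ u z y| := by
          refine Finset.sum_le_sum fun y _ => ?_
          rw [hdiff]
          exact intervalIntegral.abs_integral_le_integral_abs ht.1
      _ = ∫ u in a..t, ∑ y, |∑ z, (q u z - picard a γ c n u z) * γ u z y| :=
          (intervalIntegral.integral_finsetSum fun y _ => (hdi y).abs).symm
      _ ≤ ∫ u in a..t, M / n.factorial * (g u * (∫ r in a..u, g r) ^ n) := by
          refine intervalIntegral.integral_mono_on ht.1
            (intervalIntegrable_fun_sum _ fun y _ => (hdi y).abs)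
            ((hgit.mul_continuousOn (hFc.pow n)).const_mul _) fun u hu => ?_
          have hu' : u ∈ Icc a b := ⟨hu.1, hu.2.trans ht.2⟩
          have h0 : ∀ z, ∑ y, |γ u z y| ≤ g u := fun z =>
            Finset.single_le_sum (f := fun x => ∑ y, |γ u x y|)
              (fun _ _ => Finset.sum_nonneg fun _ _ => abs_nonneg _) (Finset.mem_univ z)
          have hg0 : 0 ≤ g u :=
            Finset.sum_nonneg fun _ _ => Finset.sum_nonneg fun _ _ => abs_nonneg _
          calc ∑ y, |∑ z, (q u z - picard a γ c n u z) * γ u z y|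
              ≤ ∑ y, ∑ z, |q u z - picard a γ c n u z| * |γ u z y| :=
                Finset.sum_le_sum fun y _ => (Finset.abs_sum_le_sum_abs _ _).trans
                  (Finset.sum_le_sum fun z _ => (abs_mul _ _).le)
            _ = ∑ z, |q u z - picard a γ c n u z| * ∑ y, |γ u z y| := by
                rw [Finset.sum_comm]; simp only [Finset.mul_sum]
            _ ≤ ∑ z, |q u z - picard a γ c n u z| * g u :=
                Finset.sum_le_sum fun z _ => mul_le_mul_of_nonneg_left (h0 z) (abs_nonneg _)
            _ = (∑ z, |q u z - picard a γ c n u z|) * g u := by rw [Finset.sum_mul]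
            _ ≤ M * ((∫ r in a..u, g r) ^ n / n.factorial) * g u :=
                mul_le_mul_of_nonneg_right (ih u hu') hg0
            _ = _ := by ring
      _ = _ := by
          rw [intervalIntegral.integral_const_mul, integral_mul_primitive_pow hgit,
            Nat.factorial_succ]
          have : (n.factorial : ℝ) ≠ 0 := by positivity
          have : (n + 1 : ℝ) ≠ 0 := by positivity
          push_cast
          field_simp

/-- The bound `M` on the initial error comes from continuity on a compact interval. Besides
uniqueness, this exhibits the solution as a limit of explicit functionals of `γ`, hence as something
measurable in ω. -/
theorem SolvesForward.tendsto_picard {a b : ℝ} {γ : ℝ → Matrix S S ℝ} {c : S → ℝ}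
    {q : ℝ → S → ℝ} (h : SolvesForward a b γ c q)
    (hγ : ∀ x y, IntervalIntegrable (fun u => γ u x y) volume a b) {t : ℝ} (ht : t ∈ Icc a b)
    (y : S) : Tendsto (fun n => picard a γ c n t y) atTop (𝓝 (q t y)) := by
  have hc : ContinuousOn (fun t => ∑ y, |q t y - c y|) (Icc a b) :=
    continuousOn_finsetSum _ fun y _ => ((h.continuousOn y).sub continuousOn_const).abs
  obtain ⟨M, hM⟩ := isCompact_Icc.bddAbove_image hc
  have hM' : ∀ t ∈ Icc a b, ∑ y, |q t y - c y| ≤ M := fun t ht => hM (mem_image_of_mem _ ht)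
  rw [tendsto_iff_dist_tendsto_zero]
  have hlim := (FloorSemiring.tendsto_pow_div_factorial_atTop
    (∫ u in a..t, ∑ x, ∑ y, |γ u x y|)).const_mul M
  rw [mul_zero] at hlim
  refine squeeze_zero (fun _ => dist_nonneg) (fun n => ?_) hlim
  refine le_trans ?_ (h.sum_abs_sub_picard_le hγ hM' n t ht)
  rw [dist_comm, Real.dist_eq]
  exact Finset.single_le_sum (f := fun y => |q t y - picard a γ c n t y|)
    (fun _ _ => abs_nonneg _) (Finset.mem_univ y)

theorem SolvesForward.unique {a b : ℝ} {γ : ℝ → Matrix S S ℝ} {c : S → ℝ}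
    {q q' : ℝ → S → ℝ} (h : SolvesForward a b γ c q) (h' : SolvesForward a b γ c q')
    (hγ : ∀ x y, IntervalIntegrable (fun u => γ u x y) volume a b) {t : ℝ} (ht : t ∈ Icc a b) :
    q t = q' t :=
  funext fun y => tendsto_nhds_unique (h.tendsto_picard hγ ht y) (h'.tendsto_picard hγ ht y)

theorem SolvesKolmogorov.solvesForward [DecidableEq S] {T : ℝ} {γ : ℝ → Matrix S S ℝ}
    {p : ℝ → ℝ → Matrix S S ℝ} (h : SolvesKolmogorov T γ p) {v : ℝ} (hv : 0 ≤ v) (x : S) :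
    SolvesForward v T γ (fun y => (1 : Matrix S S ℝ) x y) (fun t y => p v t x y) := by
  intro t ht y
  obtain ⟨h1, h2⟩ := (h v t hv ht.1 ht.2 x y).2
  simp only [Matrix.mul_apply, Matrix.sub_apply] at h1 h2
  exact ⟨h1, by linarith⟩

end Forward

/-! ### Kronecker sums and products of solutions of the Kolmogorov equations -/

section Kronecker

variable {N : ℕ} {S : Fin N → Type*}

theorem prod_update_apply (B : ∀ k, Matrix (S k) (S k) ℝ) (k : Fin N) (M : Matrix (S k) (S k) ℝ)
    (x y : ∀ k, S k) :
    ∏ i, Function.update B k M i (x i) (y i)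
      = M (x k) (y k) * ∏ i ∈ Finset.univ.erase k, B i (x i) (y i) := by
  rw [← Finset.mul_prod_erase _ _ (Finset.mem_univ k), Function.update_self]
  congr 1
  refine Finset.prod_congr rfl fun i hi => ?_
  rw [Function.update_of_ne (Finset.ne_of_mem_erase hi)]

variable [∀ k, DecidableEq (S k)]

theorem kroneckerSum_apply (A : ∀ k, Matrix (S k) (S k) ℝ) (x y : ∀ k, S k) :
    kroneckerSum A x y = ∑ k, ∏ i,
      Function.update (fun j => (1 : Matrix (S j) (S j) ℝ)) k (A k) i (x i) (y i) := by
  simp [kroneckerSum, kroneckerProd, Matrix.sum_apply]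

theorem one_apply_eq_prod (x y : ∀ k, S k) :
    (1 : Matrix (∀ k, S k) (∀ k, S k) ℝ) x y = ∏ k, (1 : Matrix (S k) (S k) ℝ) (x k) (y k) := by
  simp only [Matrix.one_apply, Finset.prod_ite_zero, funext_iff]
  simp

theorem intervalIntegrable_kroneckerSum {ψ : ∀ k, ℝ → Matrix (S k) (S k) ℝ} {a b : ℝ}
    (hψ : ∀ k x y, IntervalIntegrable (fun u => ψ k u x y) volume a b) (x y : ∀ k, S k) :
    IntervalIntegrable (fun u => kroneckerSum (fun k => ψ k u) x y) volume a b := by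
  simp only [kroneckerSum_apply, prod_update_apply]
  exact intervalIntegrable_fun_sum _ fun k _ => (hψ k _ _).mul_const _

variable [∀ k, Fintype (S k)]

/-- The fibre of the k-th coordinate is itself a product set, with a singleton as its k-th factor,
so sum and product may be exchanged. -/
theorem sum_filter_prod_apply (k : Fin N) (b : S k) (f : ∀ j, S j → ℝ) :
    ∑ y : ∀ j, S j with y k = b, ∏ j, f j (y j)
      = f k b * ∏ j ∈ Finset.univ.erase k, ∑ c, f j c := by
  rw [← Fintype.piFinset_univ, ← Fintype.piFinset_update_singleton_eq_filter_piFinset_eq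
    (fun _ => Finset.univ) k (Finset.mem_univ b), ← Finset.prod_univ_sum,
    ← Finset.mul_prod_erase _ _ (Finset.mem_univ k),
    Function.update_self, Finset.sum_singleton]
  congr 1
  refine Finset.prod_congr rfl fun i hi => ?_
  rw [Function.update_of_ne (Finset.ne_of_mem_erase hi)]

/-- A summand `j ≠ k` contributes a full row sum of `A j`, which vanishes; in the summand `k` the
identity factors sum to one. -/
theorem sum_filter_kroneckerSum {A : ∀ k, Matrix (S k) (S k) ℝ}
    (hA : ∀ k x, ∑ y, A k x y = 0) (k : Fin N) (x : ∀ k, S k) (b : S k) :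
    ∑ y : ∀ j, S j with y k = b, kroneckerSum A x y = A k (x k) b := by
  simp only [kroneckerSum_apply]
  rw [Finset.sum_comm, Finset.sum_eq_single k]
  · rw [sum_filter_prod_apply k b fun i c => Function.update
      (fun j => (1 : Matrix (S j) (S j) ℝ)) k (A k) i (x i) c, Function.update_self,
      Finset.prod_eq_one, mul_one]
    intro i hi
    simp [Function.update_of_ne (Finset.ne_of_mem_erase hi), Matrix.one_apply]
  · intro j _ hj
    rw [sum_filter_prod_apply k b fun i c => Function.update
      (fun j => (1 : Matrix (S j) (S j) ℝ)) j (A j) i (x i) c,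
      Finset.prod_eq_zero (Finset.mem_erase.2 ⟨hj, Finset.mem_univ j⟩), mul_zero]
    simp [hA]
  · simp

/-- The generator acts on functions of one coordinate through that coordinate's generator alone;
this is what the backward equation needs. -/
theorem sum_kroneckerSum_mul {A : ∀ k, Matrix (S k) (S k) ℝ}
    (hA : ∀ k x, ∑ y, A k x y = 0) (k : Fin N) (x : ∀ k, S k) (f : S k → ℝ) :
    ∑ y, kroneckerSum A x y * f (y k) = ∑ b, A k (x k) b * f b := by
  rw [← Finset.sum_fiberwise _ (fun y : ∀ j, S j => y k)]
  refine Finset.sum_congr rfl fun b _ => ?_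
  rw [← sum_filter_kroneckerSum hA k x b, Finset.sum_mul]
  refine Finset.sum_congr rfl fun y hy => ?_
  rw [(Finset.mem_filter.1 hy).2]

theorem sum_filter_one_apply (k : Fin N) (x : ∀ k, S k) (b : S k) :
    ∑ y : ∀ j, S j with y k = b, (1 : Matrix (∀ k, S k) (∀ k, S k) ℝ) x y
      = (1 : Matrix (S k) (S k) ℝ) (x k) b := by
  simp [Matrix.one_apply, Finset.sum_ite_eq]

/-- Products of solutions of forward equations solve the forward equation of the Kronecker sum. -/
theorem SolvesForward.prod {a b : ℝ} {ψ : ∀ k, ℝ → Matrix (S k) (S k) ℝ} {c : ∀ k, S k → ℝ}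
    {q : ∀ k, ℝ → S k → ℝ} (h : ∀ k, SolvesForward a b (ψ k) (c k) (q k))
    (hψ : ∀ k x y, IntervalIntegrable (fun u => ψ k u x y) volume a b) :
    SolvesForward a b (fun u => kroneckerSum fun k => ψ k u) (fun y => ∏ k, c k (y k))
      (fun t y => ∏ k, q k t (y k)) := by
  intro t ht y
  refine ⟨intervalIntegrable_sum_mul (intervalIntegrable_kroneckerSum hψ)
    (fun z => continuousOn_finsetProd _ fun k _ => (h k).continuousOn (z k)) ht y, ?_⟩
  set r : ∀ k, ℝ → ℝ := fun k u => ∑ z, q k u z * ψ k u z (y k) with hr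
  -- `q k` is controlled only on `[a, b]`. Its integral representation `Q k` is defined on the whole
  -- line, so two-sided derivatives make sense and the Leibniz rule applies almost everywhere.
  set Q : Fin N → ℝ → ℝ := fun k u => c k (y k) + ∫ s in a..u, r k s with hQ
  have hri : ∀ k, IntervalIntegrable (r k) volume a t := fun k => (h k t ht (y k)).1
  have hQq : ∀ k, ∀ u ∈ Icc a t, q k u (y k) = Q k u := fun k u hu =>
    (h k u ⟨hu.1, hu.2.trans ht.2⟩ (y k)).2
  have hac : AbsolutelyContinuousOnInterval (fun u => ∏ k, Q k u) a t :=
    absolutelyContinuousOnInterval_prod _ fun k _ =>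
      (absolutelyContinuousOnInterval_const _ a t).fun_add
        ((hri k).absolutelyContinuousOnInterval_intervalIntegral left_mem_uIcc)
  have hint := hac.integral_deriv_eq_sub
  have hder : ∫ u in a..t, deriv (fun u => ∏ k, Q k u) u
      = ∫ u in a..t, ∑ z, (∏ k, q k u (z k)) * kroneckerSum (fun k => ψ k u) z y := by
    apply intervalIntegral.integral_congr_ae
    have hall : ∀ᵐ u : ℝ, ∀ k, u ∈ uIcc a t → HasDerivAt (Q k) (r k u) u := by
      rw [ae_all_iff]
      intro k
      filter_upwards [(hri k).ae_hasDerivAt_integral] with u hu hut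
      exact (hu hut a left_mem_uIcc).const_add _
    filter_upwards [hall] with u hu hut
    have hut' : u ∈ uIcc a t := uIoc_subset_uIcc hut
    rw [(HasDerivAt.fun_finsetProd (u := Finset.univ) fun k _ => hu k hut').deriv]
    rw [uIcc_of_le ht.1] at hut'
    simp only [kroneckerSum_apply, Finset.mul_sum, ← Finset.prod_mul_distrib]
    rw [Finset.sum_comm]
    refine Finset.sum_congr rfl fun k _ => ?_
    -- The sum over `z` factorises; each identity matrix forces `z i = y i`, leaving the k-th term
    -- of the Leibniz rule.
    rw [← Fintype.piFinset_univ, ← Finset.prod_univ_sum (fun _ => Finset.univ)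
      (fun i ci => q i u ci *
        Function.update (fun j => (1 : Matrix (S j) (S j) ℝ)) k (ψ k u) i ci (y i)),
      ← Finset.mul_prod_erase _ _ (Finset.mem_univ k), Function.update_self, smul_eq_mul, mul_comm]
    congr 1
    refine Finset.prod_congr rfl fun i hi => ?_
    simp [Function.update_of_ne (Finset.ne_of_mem_erase hi), Matrix.one_apply, hQq i u hut']
  rw [hder] at hint
  rw [hint]
  have h1 : ∏ k, q k t (y k) = ∏ k, Q k t :=
    Finset.prod_congr rfl fun k _ => hQq k t ⟨ht.1, le_rfl⟩
  have h2 : ∏ k, c k (y k) = ∏ k, Q k a := by simp [hQ]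
  simp only [h1, h2]
  ring

/-- The `k`-th marginal of a matrix on a product set, along the base point `x₀`. -/
def marginalMatrix (x₀ : ∀ k, S k) (k : Fin N) (M : Matrix (∀ k, S k) (∀ k, S k) ℝ) :
    Matrix (S k) (S k) ℝ :=
  Matrix.of fun a b => ∑ y : ∀ j, S j with y k = b, M (Function.update x₀ k a) y

section Kolmogorov

variable {T : ℝ} {ψ : ∀ k, ℝ → Matrix (S k) (S k) ℝ}
  {p : ℝ → ℝ → Matrix (∀ k, S k) (∀ k, S k) ℝ}

/-- Summing the target state over a fibre collapses the Kronecker sum to `ψ k`. The resulting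
equation and its initial value involve `x` only through `x k`. -/
theorem SolvesKolmogorov.solvesForward_sum_filter
    (h : SolvesKolmogorov T (fun u => kroneckerSum fun k => ψ k u) p)
    (hrow : ∀ u ∈ Icc 0 T, ∀ k x, ∑ y, ψ k u x y = 0) {v : ℝ} (hv : 0 ≤ v) (x : ∀ k, S k)
    (k : Fin N) :
    SolvesForward v T (ψ k) (fun b => (1 : Matrix (S k) (S k) ℝ) (x k) b)
      (fun t b => ∑ y : ∀ j, S j with y k = b, p v t x y) := by
  intro t ht b
  have hf := h.solvesForward hv x
  have heq : ∀ u ∈ Icc 0 T,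
      ∑ y : ∀ j, S j with y k = b, ∑ z, p v u x z * kroneckerSum (fun k => ψ k u) z y
        = ∑ c, (∑ y : ∀ j, S j with y k = c, p v u x y) * ψ k u c b := by
    intro u hu
    rw [Finset.sum_comm]
    simp only [← Finset.mul_sum, sum_filter_kroneckerSum (hrow u hu)]
    rw [← Finset.sum_fiberwise _ (fun y : ∀ j, S j => y k)]
    refine Finset.sum_congr rfl fun c _ => ?_
    rw [Finset.sum_mul]
    refine Finset.sum_congr rfl fun y hy => ?_
    rw [(Finset.mem_filter.1 hy).2]
  have hsub : uIcc v t ⊆ Icc 0 T := by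
    rw [uIcc_of_le ht.1]; exact Icc_subset_Icc hv ht.2
  refine ⟨(intervalIntegrable_congr fun u hu => heq u (hsub (uIoc_subset_uIcc hu))).1
    (intervalIntegrable_fun_sum _ fun y _ => (hf t ht y).1), ?_⟩
  rw [← intervalIntegral.integral_congr fun u hu => heq u (hsub hu),
    intervalIntegral.integral_finsetSum fun y _ => (hf t ht y).1]
  simp only [← sum_filter_one_apply, ← Finset.sum_add_distrib]
  exact Finset.sum_congr rfl fun y _ => (hf t ht y).2

/-- Lumpability: two starting points with the same k-th coordinate yield solutions of the same
forward equation with the same initial value. Hence the base point `x₀` is immaterial. -/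
theorem SolvesKolmogorov.sum_filter_eq_marginalMatrix
    (h : SolvesKolmogorov T (fun u => kroneckerSum fun k => ψ k u) p)
    (hrow : ∀ u ∈ Icc 0 T, ∀ k x, ∑ y, ψ k u x y = 0)
    (hψ : ∀ k x y, IntervalIntegrable (fun u => ψ k u x y) volume 0 T) (x₀ : ∀ k, S k)
    {v t : ℝ} (hv : 0 ≤ v) (hvt : v ≤ t) (ht : t ≤ T) (k : Fin N) (x : ∀ k, S k) (b : S k) :
    ∑ y : ∀ j, S j with y k = b, p v t x y = marginalMatrix x₀ k (p v t) (x k) b := by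
  have hf := h.solvesForward_sum_filter hrow hv x k
  have hf' := h.solvesForward_sum_filter hrow hv (Function.update x₀ k (x k)) k
  rw [Function.update_self] at hf'
  have hψ' : ∀ x y, IntervalIntegrable (fun u => ψ k u x y) volume v T := fun x y =>
    (hψ k x y).mono_set (by
      rw [uIcc_of_le (hvt.trans ht), uIcc_of_le (hv.trans (hvt.trans ht))]
      exact Icc_subset_Icc_left hv)
  exact congr_fun (hf.unique hf' hψ' ⟨hvt, ht⟩) b

/-- The marginals of a solution for a Kronecker sum solve the marginal Kolmogorov equations. -/
theorem SolvesKolmogorov.marginalMatrix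
    (h : SolvesKolmogorov T (fun u => kroneckerSum fun k => ψ k u) p)
    (hrow : ∀ u ∈ Icc 0 T, ∀ k x, ∑ y, ψ k u x y = 0)
    (hψ : ∀ k x y, IntervalIntegrable (fun u => ψ k u x y) volume 0 T) (x₀ : ∀ k, S k)
    (k : Fin N) : SolvesKolmogorov T (ψ k) (fun v t => marginalMatrix x₀ k (p v t)) := by
  intro v t hv hvt ht a b
  have hsub : uIcc v t ⊆ Icc 0 T := by rw [uIcc_of_le hvt]; exact Icc_subset_Icc hv ht
  constructor
  · have hb := fun y => (h v t hv hvt ht (Function.update x₀ k a) y).1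
    have heq : ∀ u ∈ uIcc v t, ∑ y : ∀ j, S j with y k = b,
        ((kroneckerSum fun k => ψ k u) * p u t) (Function.update x₀ k a) y
          = (ψ k u * CondMarkov.marginalMatrix x₀ k (p u t)) a b := by
      intro u hu
      have hu' := hu
      rw [uIcc_of_le hvt] at hu'
      simp only [Matrix.mul_apply]
      rw [Finset.sum_comm]
      simp only [← Finset.mul_sum]
      -- The backward equation mixes starting states, so lumpability has to come first: it makes the
      -- factor a function of the k-th coordinate alone.
      simp only [h.sum_filter_eq_marginalMatrix hrow hψ x₀ (hv.trans hu'.1) hu'.2 ht]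
      rw [sum_kroneckerSum_mul (hrow u (hsub hu)) k _
        (fun c => CondMarkov.marginalMatrix x₀ k (p u t) c b), Function.update_self]
    refine ⟨(intervalIntegrable_congr fun u hu => heq u (uIoc_subset_uIcc hu)).1
      (intervalIntegrable_fun_sum _ fun y _ => (hb y).1), ?_⟩
    rw [← intervalIntegral.integral_congr heq,
      intervalIntegral.integral_finsetSum fun y _ => (hb y).1,
      ← Finset.sum_congr rfl fun y _ => (hb y).2]
    have hone := sum_filter_one_apply k (Function.update x₀ k a) b
    rw [Function.update_self] at hone
    rw [Matrix.sub_apply, ← hone]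
    exact (Finset.sum_sub_distrib _ _).symm
  · have hf := h.solvesForward_sum_filter hrow hv (Function.update x₀ k a) k t ⟨hvt, ht⟩ b
    rw [Function.update_self] at hf
    simp only [Matrix.mul_apply, Matrix.sub_apply]
    exact ⟨hf.1, sub_eq_of_eq_add' hf.2⟩

/-- A solution of the Kolmogorov equations of a Kronecker sum is the Kronecker product of its
marginals. -/
theorem SolvesKolmogorov.eq_prod_marginalMatrix
    (h : SolvesKolmogorov T (fun u => kroneckerSum fun k => ψ k u) p)
    (hrow : ∀ u ∈ Icc 0 T, ∀ k x, ∑ y, ψ k u x y = 0)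
    (hψ : ∀ k x y, IntervalIntegrable (fun u => ψ k u x y) volume 0 T) (x₀ : ∀ k, S k)
    {v t : ℝ} (hv : 0 ≤ v) (hvt : v ≤ t) (ht : t ≤ T) (x y : ∀ k, S k) :
    p v t x y = ∏ k, CondMarkov.marginalMatrix x₀ k (p v t) (x k) (y k) := by
  have hψ' : ∀ k x y, IntervalIntegrable (fun u => ψ k u x y) volume v T := fun k x y =>
    (hψ k x y).mono_set (by
      rw [uIcc_of_le (hvt.trans ht), uIcc_of_le (hv.trans (hvt.trans ht))]
      exact Icc_subset_Icc_left hv)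
  have h1 := SolvesForward.prod
    (fun k => (h.marginalMatrix hrow hψ x₀ k).solvesForward hv (x k)) hψ'
  simp only [← one_apply_eq_prod] at h1
  exact congr_fun ((h.solvesForward hv x).unique h1 (intervalIntegrable_kroneckerSum hψ')
    ⟨hvt, ht⟩) y

end Kolmogorov

theorem marginalMatrix_nonneg {M : Matrix (∀ k, S k) (∀ k, S k) ℝ} (hM : ∀ x y, 0 ≤ M x y)
    (x₀ : ∀ k, S k) (k : Fin N) (a b : S k) : 0 ≤ marginalMatrix x₀ k M a b :=
  Finset.sum_nonneg fun _ _ => hM _ _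

theorem sum_marginalMatrix {M : Matrix (∀ k, S k) (∀ k, S k) ℝ} (hM : ∀ x, ∑ y, M x y = 1)
    (x₀ : ∀ k, S k) (k : Fin N) (a : S k) : ∑ b, marginalMatrix x₀ k M a b = 1 :=
  (Finset.sum_fiberwise _ (fun y : ∀ j, S j => y k) _).trans (hM _)

end Kronecker

/-! ### Measurability of the Picard iterates, integrability of intensity processes -/

section Measurability

variable {Ω S : Type*} [Fintype S]

/-- The moving endpoint is absorbed into an indicator that is jointly measurable with the integrand,
and measurability of parametric integrals applies. -/
theorem measurable_intervalIntegral_prod {m : MeasurableSpace Ω} {g : ℝ → Ω → ℝ}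
    (hg : Measurable (Function.uncurry g)) (a : ℝ) :
    Measurable (fun q : ℝ × Ω => ∫ r in a..q.1, g r q.2) := by
  have hmeas : ∀ {s : Set ((ℝ × Ω) × ℝ)}, MeasurableSet s →
      Measurable (fun q : ℝ × Ω => ∫ r, s.indicator (fun w => g w.2 w.1.2) (q, r)) := by
    intro s hs
    have h1 : Measurable (s.indicator (fun w : (ℝ × Ω) × ℝ => g w.2 w.1.2)) :=
      (hg.comp (measurable_snd.prodMk (measurable_snd.comp measurable_fst))).indicator hs
    exact h1.stronglyMeasurable.integral_prod_right'.measurable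
  have hs1 : MeasurableSet {w : (ℝ × Ω) × ℝ | a < w.2 ∧ w.2 ≤ w.1.1} :=
    (measurableSet_lt measurable_const measurable_snd).inter
      (measurableSet_le measurable_snd (measurable_fst.comp measurable_fst))
  have hs2 : MeasurableSet {w : (ℝ × Ω) × ℝ | w.1.1 < w.2 ∧ w.2 ≤ a} :=
    (measurableSet_lt (measurable_fst.comp measurable_fst) measurable_snd).inter
      (measurableSet_le measurable_snd measurable_const)
  convert! (hmeas hs1).sub (hmeas hs2) using 1
  ext q
  rw [intervalIntegral, ← integral_indicator measurableSet_Ioc,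
    ← integral_indicator measurableSet_Ioc]
  rfl

theorem measurable_projIcc_prodMk {m : MeasurableSpace Ω} {a b : ℝ} (hab : a ≤ b) :
    Measurable (fun q : ℝ × Ω => (projIcc a b hab q.1, q.2)) :=
  (continuous_projIcc.measurable.comp measurable_fst).prodMk measurable_snd

theorem measurable_picard {m : MeasurableSpace Ω} {Γ : ℝ → Ω → Matrix S S ℝ}
    (hΓ : ∀ x y, Measurable (Function.uncurry fun u ω => Γ u ω x y)) (a : ℝ) (c : S → ℝ)
    (n : ℕ) (y : S) :
    Measurable (fun q : ℝ × Ω => picard a (fun u => Γ u q.2) c n q.1 y) := by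
  induction n generalizing y with
  | zero => exact measurable_const
  | succ n ih =>
    refine measurable_const.add (measurable_intervalIntegral_prod
      (g := fun u ω => ∑ z, picard a (fun u => Γ u ω) c n u z * Γ u ω z y) ?_ a)
    exact Finset.measurable_sum _ fun z _ => (ih z).mul (hΓ z y)

theorem SolvesForward.congr {a b : ℝ} {γ γ' : ℝ → Matrix S S ℝ} {c : S → ℝ}
    {q : ℝ → S → ℝ} (h : SolvesForward a b γ c q) (hγ : ∀ u ∈ Icc a b, γ u = γ' u) :
    SolvesForward a b γ' c q := by
  intro t ht y
  have heq : ∀ u ∈ uIcc a t, ∑ z, q u z * γ u z y = ∑ z, q u z * γ' u z y := by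
    intro u hu
    rw [uIcc_of_le ht.1] at hu
    rw [hγ u ⟨hu.1, hu.2.trans ht.2⟩]
  rw [← intervalIntegral.integral_congr heq,
    ← intervalIntegrable_congr fun u hu => heq u (uIoc_subset_uIcc hu)]
  exact h t ht y

variable [mΩ : MeasurableSpace Ω] {𝓕 : Filtration ℝ mΩ} {T : ℝ} {P : Measure Ω}
  {Γ : ℝ → Ω → Matrix S S ℝ}

/-- Progressive measurability at time `T` concerns only `[0, T] × Ω`. Clamping time extends it to
the line, where the Picard iterates are formed. -/
theorem IsIntensityProcess.measurable_projIcc (h : IsIntensityProcess 𝓕 T P Γ) (hT : 0 ≤ T)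
    (x y : S) :
    Measurable[MeasurableSpace.prod inferInstance (𝓕 T)]
      (Function.uncurry fun (u : ℝ) ω => Γ (projIcc 0 T hT u) ω x y) := by
  have h1 := h.progMeasurable T ⟨hT, le_rfl⟩ x y
  exact h1.comp (measurable_projIcc_prodMk (m := 𝓕 T) hT)

/-- Zero row sums and nonnegative off-diagonal entries bound each off-diagonal entry by minus the
diagonal one. -/
theorem IsIntensityProcess.ae_intervalIntegrable (h : IsIntensityProcess 𝓕 T P Γ) (hT : 0 ≤ T) :
    ∀ᵐ ω ∂P, ∀ x y, IntervalIntegrable (fun u => Γ u ω x y) volume 0 T := by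
  filter_upwards [h.nonneg, h.row_sum, h.integrable] with ω h1 h2 h3 x y
  by_cases hxy : x = y
  · exact hxy ▸ h3 x
  have hmeas : AEStronglyMeasurable (fun u => Γ u ω x y) (volume.restrict (uIoc 0 T)) := by
    have h4 : Measurable fun u => Γ (projIcc 0 T hT u) ω x y :=
      (h.measurable_projIcc hT x y).comp (@measurable_prodMk_right _ _ _ (𝓕 T) ω)
    refine h4.aestronglyMeasurable.congr ?_
    filter_upwards [ae_restrict_mem measurableSet_uIoc] with u hu
    rw [uIoc_of_le hT] at hu
    rw [projIcc_of_mem hT ⟨hu.1.le, hu.2⟩]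
  refine (h3 x).mono_fun hmeas ?_
  filter_upwards [ae_restrict_mem measurableSet_uIoc] with u hu
  rw [uIoc_of_le hT] at hu
  have hu' : u ∈ Icc 0 T := ⟨hu.1.le, hu.2⟩
  have h0 := h1 u hu' x y hxy
  have h5 := h2 u hu' x
  classical
  rw [← Finset.add_sum_erase _ _ (Finset.mem_univ x)] at h5
  have h6 : Γ u ω x y ≤ ∑ z ∈ Finset.univ.erase x, Γ u ω x z :=
    Finset.single_le_sum (f := fun z => Γ u ω x z)
      (fun z hz => h1 u hu' x z (Finset.ne_of_mem_erase hz).symm)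
      (Finset.mem_erase.2 ⟨Ne.symm hxy, Finset.mem_univ y⟩)
  rw [Real.norm_eq_abs, Real.norm_eq_abs, abs_of_nonneg h0]
  exact (by linarith : Γ u ω x y ≤ -Γ u ω x x).trans (neg_le_abs _)

variable [DecidableEq S]

/-- The Kolmogorov equations determine the transition matrices even for two probability measures
that are only comparable on `𝓕 T`. -/
theorem ae_eq_of_solvesKolmogorov {Q : Measure Ω} (hT : 0 ≤ T)
    (hPQ : P.trim (𝓕.le T) ≪ Q.trim (𝓕.le T))
    (hΓP : IsIntensityProcess 𝓕 T P Γ) (hΓQ : IsIntensityProcess 𝓕 T Q Γ)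
    {p q : ℝ → ℝ → Ω → Matrix S S ℝ}
    (hp : ∀ᵐ ω ∂P, SolvesKolmogorov T (fun u => Γ u ω) fun s t => p s t ω)
    (hq : ∀ᵐ ω ∂Q, SolvesKolmogorov T (fun u => Γ u ω) fun s t => q s t ω)
    {s t : ℝ} (hs : 0 ≤ s) (hst : s ≤ t) (ht : t ≤ T) (x y : S)
    (hqm : Measurable[𝓕 T] fun ω => q s t ω x y) :
    (fun ω => p s t ω x y) =ᵐ[P] fun ω => q s t ω x y := by
  set Γ' : ℝ → Ω → Matrix S S ℝ := fun u ω => Γ (projIcc 0 T hT u) ω with hΓ'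
  set J : ℕ → Ω → ℝ := fun n ω =>
    picard s (fun u => Γ' u ω) (fun y => (1 : Matrix S S ℝ) x y) n t y with hJ
  have hJm : ∀ n, Measurable[𝓕 T] (J n) := fun n =>
    (measurable_picard (m := 𝓕 T) (fun x y => hΓP.measurable_projIcc hT x y) s _ n y).comp
      (@measurable_prodMk_left _ _ _ (𝓕 T) t)
  have key : ∀ {ω : Ω} {r : ℝ → ℝ → Matrix S S ℝ},
      (∀ x y, IntervalIntegrable (fun u => Γ u ω x y) volume 0 T) →
      SolvesKolmogorov T (fun u => Γ u ω) r →
      Tendsto (fun n => J n ω) atTop (𝓝 (r s t x y)) := by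
    intro ω r hi hr
    have hsT : s ≤ T := hst.trans ht
    have heq : ∀ u ∈ Icc s T, Γ u ω = Γ' u ω := fun u hu => by
      simp only [hΓ', projIcc_of_mem hT ⟨hs.trans hu.1, hu.2⟩]
    refine SolvesForward.tendsto_picard (q := fun t y => r s t x y) (b := T)
      ((hr.solvesForward hs x).congr heq) (fun x y => ?_) ⟨hst, ht⟩ y
    refine (intervalIntegrable_congr fun u hu => ?_).1 ((hi x y).mono_set
      (show uIcc s T ⊆ uIcc 0 T by
        rw [uIcc_of_le hsT, uIcc_of_le hT]; exact Icc_subset_Icc_left hs))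
    rw [uIoc_of_le hsT] at hu
    simp only [heq u ⟨hu.1.le, hu.2⟩]
  have hQ : ∀ᵐ ω ∂Q, Tendsto (fun n => J n ω - q s t ω x y) atTop (𝓝 0) := by
    filter_upwards [hΓQ.ae_intervalIntegrable hT, hq] with ω h1 h2
    simpa using (key h1 h2).sub_const (q s t ω x y)
  -- Solving the Kolmogorov equations is not visibly an `𝓕 T`-event, but convergence of the iterates
  -- to `q` is, so it can be carried from `Q` to `P`.
  have hset : MeasurableSet[𝓕 T] {ω | Tendsto (fun n => J n ω - q s t ω x y) atTop (𝓝 0)} :=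
    @measurableSet_tendsto _ _ _ (𝓕 T) _ _ _ _ _ _ _ _ fun n => (hJm n).sub hqm
  have hP : ∀ᵐ ω ∂P, Tendsto (fun n => J n ω - q s t ω x y) atTop (𝓝 0) := by
    refine ae_of_ae_trim (𝓕.le T) (hPQ.ae_le ?_)
    exact mem_ae_iff.2 ((trim_measurableSet_eq (𝓕.le T) hset.compl).trans (mem_ae_iff.1 hQ))
  filter_upwards [hΓP.ae_intervalIntegrable hT, hp, hP] with ω h1 h2 h3
  have h4 := (key h1 h2).sub_const (q s t ω x y)
  exact sub_eq_zero.1 (tendsto_nhds_unique h4 h3)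

end Measurability

/-! ### Conditional expectations -/

section CondExp

variable {Ω : Type*} {m m' : MeasurableSpace Ω} [mΩ : MeasurableSpace Ω] {P : Measure Ω}
  [IsFiniteMeasure P]

/-- Integrals do not see null sets, so it suffices that `m'` lies in `m` up to null sets. A
completed filtration need not lie in the original one in the strict sense. -/
theorem condExp_ae_eq_of_le_eventuallyMeasurableSpace (hm : m ≤ mΩ)
    (hm' : m' ≤ mΩ) (hle : m' ≤ eventuallyMeasurableSpace m (ae P)) {f g : Ω → ℝ}
    (hf : Integrable f P) (hfg : P[f|m] =ᵐ[P] g) (hg : AEStronglyMeasurable[m'] g P) :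
    P[f|m'] =ᵐ[P] g := by
  have hgi : Integrable g P := integrable_condExp.congr hfg
  refine (ae_eq_condExp_of_forall_setIntegral_eq hm' hf (fun _ _ _ => hgi.integrableOn)
    (fun s hs _ => ?_) hg).symm
  obtain ⟨s', hs', hss'⟩ := hle s hs
  rw [setIntegral_congr_set hss', setIntegral_congr_set hss',
    ← setIntegral_congr_ae (hm _ hs') (hfg.mono fun _ h _ => h), setIntegral_condExp hm hf hs']

theorem condExp_ae_eq_of_le (hm : m ≤ mΩ) (hle : m' ≤ m) {f g : Ω → ℝ}
    (hf : Integrable f P) (hfg : P[f|m] =ᵐ[P] g) (hg : AEStronglyMeasurable[m'] g P) :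
    P[f|m'] =ᵐ[P] g :=
  condExp_ae_eq_of_le_eventuallyMeasurableSpace hm (hle.trans hm)
    (hle.trans le_eventuallyMeasurableSpace) hf hfg hg

theorem integrable_indicator_one {A : Set Ω} (hA : MeasurableSet A) :
    Integrable (A.indicator fun _ => (1 : ℝ)) P :=
  (integrable_const 1).indicator hA

theorem ae_condExp_indicator_mem_Icc (A : Set Ω)
    (hA : MeasurableSet A) : ∀ᵐ ω ∂P, (P⟦A|m⟧) ω ∈ Icc (0 : ℝ) 1 := by
  have h0 : 0 ≤ᵐ[P] P⟦A|m⟧ :=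
    condExp_nonneg (ae_of_all _ fun ω => indicator_nonneg (fun _ _ => zero_le_one) ω)
  by_cases hm : m ≤ mΩ
  · have h1 : P⟦A|m⟧ ≤ᵐ[P] P[fun _ => (1 : ℝ)|m] :=
      condExp_mono (integrable_indicator_one hA) (integrable_const 1)
        (ae_of_all _ fun ω => indicator_le_self' (fun _ _ => zero_le_one) ω)
    rw [condExp_const hm] at h1
    filter_upwards [h0, h1] with ω h0 h1 using ⟨h0, h1⟩
  · rw [condExp_of_not_le hm]
    exact ae_of_all _ fun ω => ⟨le_rfl, zero_le_one⟩

theorem comp_eq_sum_mul_indicator {α S : Type*} [Fintype S] (φ : S → α → ℝ) (Z : α → S) :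
    (fun ω => φ (Z ω) ω) = ∑ y, φ y * {ω | Z ω = y}.indicator fun _ => (1 : ℝ) := by
  ext ω
  rw [Finset.sum_apply, Finset.sum_eq_single (Z ω) (fun y _ hy => by simp [hy.symm]) (by simp)]
  simp

theorem integrable_mul_indicator {Ω S : Type*} [MeasurableSpace Ω] {P : Measure Ω}
    [MeasurableSpace S] [MeasurableSingletonClass S] {Z : Ω → S} (hZ : Measurable Z) {φ : Ω → ℝ}
    (hφ : Integrable φ P) (y : S) :
    Integrable (φ * {ω | Z ω = y}.indicator fun _ => (1 : ℝ)) P := by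
  have : φ * ({ω | Z ω = y}.indicator fun _ => (1 : ℝ)) = {ω | Z ω = y}.indicator φ := by
    ext ω; by_cases h : Z ω = y <;> simp [h]
  rw [this]
  exact hφ.indicator (hZ (measurableSet_singleton y))

variable {S : Type*} [Fintype S] [MeasurableSpace S] [MeasurableSingletonClass S]

/-- Averaging over the state, for coefficients that are known. -/
theorem condExp_comp_of_stronglyMeasurable {Z : Ω → S}
    (hZ : Measurable Z) {φ : S → Ω → ℝ} (hφ : ∀ y, Integrable (φ y) P)
    (hφm : ∀ y, StronglyMeasurable[m] (φ y)) :
    P[fun ω => φ (Z ω) ω|m] =ᵐ[P] fun ω => ∑ y, φ y ω * (P⟦{ω | Z ω = y}|m⟧) ω := by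
  rw [comp_eq_sum_mul_indicator φ Z]
  refine (condExp_finsetSum (fun y _ => integrable_mul_indicator hZ (hφ y) y) m).trans ?_
  have h : ∀ᵐ ω ∂P, ∀ y, P[φ y * {ω | Z ω = y}.indicator fun _ => (1 : ℝ)|m] ω
      = φ y ω * (P⟦{ω | Z ω = y}|m⟧) ω := by
    rw [ae_all_iff]
    exact fun y => condExp_mul_of_stronglyMeasurable_left (hφm y)
      (integrable_mul_indicator hZ (hφ y) y)
      (integrable_indicator_one (hZ (measurableSet_singleton y)))
  filter_upwards [h] with ω hω
  rw [Finset.sum_apply]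
  exact Finset.sum_congr rfl fun y _ => hω y

end CondExp

/-- Averaging over the coefficients, for a state that is known. -/
theorem condExp_comp_of_measurable {Ω S : Type*} {m : MeasurableSpace Ω} [mΩ : MeasurableSpace Ω]
    {P : Measure Ω} [Fintype S] [MeasurableSpace S] [MeasurableSingletonClass S] (hm : m ≤ mΩ)
    {Z : Ω → S}
    (hZ : Measurable[m] Z) {φ : S → Ω → ℝ} (hφ : ∀ y, Integrable (φ y) P) :
    P[fun ω => φ (Z ω) ω|m] =ᵐ[P] fun ω => P[φ (Z ω)|m] ω := by
  have hZ' : Measurable Z := hZ.mono hm le_rfl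
  rw [comp_eq_sum_mul_indicator φ Z, comp_eq_sum_mul_indicator (fun y => P[φ y|m]) Z]
  refine (condExp_finsetSum (fun y _ => integrable_mul_indicator hZ' (hφ y) y) m).trans ?_
  have h : ∀ᵐ ω ∂P, ∀ y, P[φ y * {ω | Z ω = y}.indicator fun _ => (1 : ℝ)|m] ω
      = (P[φ y|m] * {ω | Z ω = y}.indicator fun _ => (1 : ℝ)) ω := by
    rw [ae_all_iff]
    exact fun y => condExp_mul_of_stronglyMeasurable_right
      (stronglyMeasurable_const.indicator (hZ (measurableSet_singleton y)))
      (integrable_mul_indicator hZ' (hφ y) y) (hφ y)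
  filter_upwards [h] with ω hω
  rw [Finset.sum_apply, Finset.sum_apply]
  exact Finset.sum_congr rfl fun y _ => hω y

/-! ### Finite-dimensional conditional laws -/

section FiniteDimensional

theorem IsAdaptedCadlag.measurable {Ω S : Type*} [mΩ : MeasurableSpace Ω] [MeasurableSpace S]
    {𝓗 : ℝ → MeasurableSpace Ω} {T : ℝ} {Z : ℝ → Ω → S} (hZ : IsAdaptedCadlag T 𝓗 Z) {t : ℝ}
    (ht : t ∈ Icc 0 T) : Measurable (Z t) :=
  (hZ.adapted t ht).mono (hZ.le t ht) le_rfl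

variable {Ω S : Type*} [Fintype S]

/-- The conditional expectation of `∏ i, g i (Z (τ i))` for a chain started from `x` at time `s`
with transition matrices `p`. -/
def pathWeight (p : ℝ → ℝ → Ω → Matrix S S ℝ) :
    (n : ℕ) → ℝ → (Fin n → ℝ) → (Fin n → S → ℝ) → S → Ω → ℝ
  | 0, _, _, _, _, _ => 1
  | n + 1, s, τ, g, x, ω =>
    ∑ y, p s (τ 0) ω x y * (g 0 y * pathWeight p n (τ 0) (Fin.tail τ) (Fin.tail g) y ω)

variable [mΩ : MeasurableSpace Ω] [MeasurableSpace S] {𝓕 : Filtration ℝ mΩ}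
  {𝓗 : ℝ → MeasurableSpace Ω} {T : ℝ} {P : Measure Ω} {Z : ℝ → Ω → S}
  {p : ℝ → ℝ → Ω → Matrix S S ℝ}

theorem tail_times {n : ℕ} {τ : Fin (n + 1) → ℝ} (hτ : Monotone τ) (hτT : ∀ i, τ i ≤ T) :
    Monotone (Fin.tail τ) ∧ ∀ i, τ 0 ≤ Fin.tail τ i ∧ Fin.tail τ i ≤ T :=
  ⟨fun _ _ hij => hτ (Fin.succ_le_succ_iff.2 hij), fun _ => ⟨hτ (Fin.zero_le _), hτT _⟩⟩

theorem IsCTransitionField.measurable_pathWeight (hp : IsCTransitionField 𝓕 𝓗 T P Z p) {n : ℕ}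
    {s u : ℝ} (hs : 0 ≤ s) {τ : Fin n → ℝ} (hτ : Monotone τ) (hsτ : ∀ i, s ≤ τ i ∧ τ i ≤ u)
    (hu : u ≤ T) (g : Fin n → S → ℝ) (x : S) :
    Measurable[𝓕 u] (pathWeight p n s τ g x) := by
  induction n generalizing s x with
  | zero => exact measurable_const
  | succ n ih =>
    obtain ⟨h1, h2⟩ := tail_times hτ fun i => (hsτ i).2
    refine Finset.measurable_sum _ fun y _ => Measurable.mul ?_ (measurable_const.mul
      (ih (hs.trans (hsτ 0).1) h1 h2 _ y))
    exact (hp.measurable s (τ 0) hs (hsτ 0).1 ((hsτ 0).2.trans hu) x y).mono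
      (𝓕.mono (hsτ 0).2) le_rfl

theorem IsCTransitionField.ae_abs_pathWeight_le (hp : IsCTransitionField 𝓕 𝓗 T P Z p) {n : ℕ}
    {s : ℝ} (hs : 0 ≤ s) {τ : Fin n → ℝ} (hτ : Monotone τ) (hsτ : ∀ i, s ≤ τ i ∧ τ i ≤ T)
    {g : Fin n → S → ℝ} (hg : ∀ i y, |g i y| ≤ 1) :
    ∀ᵐ ω ∂P, ∀ x, |pathWeight p n s τ g x ω| ≤ 1 := by
  induction n generalizing s with
  | zero => exact ae_of_all _ fun ω x => by simp [pathWeight]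
  | succ n ih =>
    obtain ⟨h1, h2⟩ := tail_times hτ fun i => (hsτ i).2
    filter_upwards [ih (hs.trans (hsτ 0).1) h1 h2 (g := Fin.tail g) (fun _ y => hg _ y),
      hp.stochastic s (τ 0) hs (hsτ 0).1 (hsτ 0).2] with ω hω hst x
    calc |pathWeight p (n + 1) s τ g x ω|
        ≤ ∑ y, |p s (τ 0) ω x y *
            (g 0 y * pathWeight p n (τ 0) (Fin.tail τ) (Fin.tail g) y ω)| :=
          Finset.abs_sum_le_sum_abs _ _
      _ ≤ ∑ y, p s (τ 0) ω x y := by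
          refine Finset.sum_le_sum fun y _ => ?_
          rw [abs_mul, abs_mul, abs_of_nonneg (hst.1 x y)]
          exact mul_le_of_le_one_right (hst.1 x y)
            (mul_le_one₀ (hg 0 y) (abs_nonneg _) (hω y))
      _ = 1 := hst.2 x

theorem IsCTransitionField.integrable_pathWeight [IsFiniteMeasure P]
    (hp : IsCTransitionField 𝓕 𝓗 T P Z p) {n : ℕ}
    {s : ℝ} (hs : 0 ≤ s) {τ : Fin n → ℝ} (hτ : Monotone τ) (hsτ : ∀ i, s ≤ τ i ∧ τ i ≤ T)
    {g : Fin n → S → ℝ} (hg : ∀ i y, |g i y| ≤ 1) (x : S) :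
    Integrable (pathWeight p n s τ g x) P :=
  Integrable.of_bound
    (((hp.measurable_pathWeight hs hτ hsτ le_rfl g x).mono (𝓕.le T) le_rfl).aestronglyMeasurable)
    1 ((hp.ae_abs_pathWeight_le hs hτ hsτ hg).mono fun _ h => h x)

variable [MeasurableSingletonClass S]

theorem integrable_prod_comp [IsFiniteMeasure P] (hZ : IsAdaptedCadlag T 𝓗 Z) {n : ℕ}
    {τ : Fin n → ℝ} (hτ : ∀ i, 0 ≤ τ i ∧ τ i ≤ T) {g : Fin n → S → ℝ}
    (hg : ∀ i y, |g i y| ≤ 1) : Integrable (fun ω => ∏ i, g i (Z (τ i) ω)) P := by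
  refine Integrable.of_bound (Measurable.aestronglyMeasurable ?_) 1 (ae_of_all _ fun ω => ?_)
  · exact Finset.measurable_prod _ fun i _ =>
      (measurable_of_finite (g i)).comp (hZ.measurable (hτ i))
  · rw [Real.norm_eq_abs, Finset.abs_prod]
    exact Finset.prod_le_one (fun _ _ => abs_nonneg _) fun i _ => hg i _

/-- Induction on the number of times, with the tower property at the first one. The weight of the
remaining path is `𝓕 T`-measurable, hence known at time `s`, and only the law of the next state
remains to be averaged. -/
theorem IsCTransitionField.condExp_prod [IsFiniteMeasure P]
    (hp : IsCTransitionField 𝓕 𝓗 T P Z p) (hZ : IsAdaptedCadlag T 𝓗 Z)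
    (h𝓗 : MonotoneOn 𝓗 (Icc 0 T)) {n : ℕ} {s : ℝ} (hs : s ∈ Icc 0 T) {τ : Fin n → ℝ}
    (hτ : Monotone τ) (hsτ : ∀ i, s ≤ τ i ∧ τ i ≤ T) {g : Fin n → S → ℝ}
    (hg : ∀ i y, |g i y| ≤ 1) :
    P[fun ω => ∏ i, g i (Z (τ i) ω)|𝓕 T ⊔ 𝓗 s] =ᵐ[P]
      fun ω => pathWeight p n s τ g (Z s ω) ω := by
  have hle : ∀ t ∈ Icc 0 T, 𝓕 T ⊔ 𝓗 t ≤ mΩ := fun t ht => sup_le (𝓕.le T) (hZ.le t ht)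
  induction n generalizing s with
  | zero =>
    simp only [Finset.univ_eq_empty, Finset.prod_empty, pathWeight]
    rw [condExp_const (hle s hs)]
  | succ n ih =>
    obtain ⟨h1, h2⟩ := tail_times hτ fun i => (hsτ i).2
    have ht : τ 0 ∈ Icc 0 T := ⟨hs.1.trans (hsτ 0).1, (hsτ 0).2⟩
    have hg' : ∀ i y, |Fin.tail g i y| ≤ 1 := fun _ y => hg _ y
    have hih := ih ht h1 h2 hg'
    set R : Ω → ℝ := fun ω => ∏ i, Fin.tail g i (Z (Fin.tail τ i) ω) with hR
    set W : S → Ω → ℝ := pathWeight p n (τ 0) (Fin.tail τ) (Fin.tail g) with hW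
    have hRi : Integrable R P := integrable_prod_comp hZ
      (fun i => ⟨ht.1.trans (h2 i).1, (h2 i).2⟩) hg'
    have hprod : (fun ω => ∏ i, g i (Z (τ i) ω)) = (fun ω => g 0 (Z (τ 0) ω)) * R := by
      ext ω; rw [Fin.prod_univ_succ]; rfl
    have hprodi : Integrable ((fun ω => g 0 (Z (τ 0) ω)) * R) P := by
      rw [← hprod]
      exact integrable_prod_comp hZ (fun i => ⟨hs.1.trans (hsτ i).1, (hsτ i).2⟩) hg
    have hZm : Measurable[𝓕 T ⊔ 𝓗 (τ 0)] (Z (τ 0)) :=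
      (hZ.adapted _ ht).mono le_sup_right le_rfl
    have hle' : 𝓕 T ⊔ 𝓗 s ≤ 𝓕 T ⊔ 𝓗 (τ 0) := sup_le_sup_left (h𝓗 hs ht (hsτ 0).1) _
    have hstep1 : P[(fun ω => g 0 (Z (τ 0) ω)) * R|𝓕 T ⊔ 𝓗 (τ 0)] =ᵐ[P]
        fun ω => g 0 (Z (τ 0) ω) * W (Z (τ 0) ω) ω := by
      refine (condExp_mul_of_stronglyMeasurable_left
        (((measurable_of_finite (g 0)).comp hZm).stronglyMeasurable) hprodi hRi).trans ?_
      filter_upwards [hih] with ω hω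
      simp only [Pi.mul_apply, hω, Function.comp_apply]
    have hWi : ∀ y, Integrable (fun ω => g 0 y * W y ω) P := fun y =>
      (hp.integrable_pathWeight ht.1 h1 h2 hg' y).const_mul _
    have hWm : ∀ y, StronglyMeasurable[𝓕 T ⊔ 𝓗 s] (fun ω => g 0 y * W y ω) := fun y =>
      (((hp.measurable_pathWeight ht.1 h1 h2 le_rfl (Fin.tail g) y).mono
        (le_sup_left : 𝓕 T ≤ 𝓕 T ⊔ 𝓗 s) le_rfl).const_mul (g 0 y)).stronglyMeasurable
    have htrans : ∀ᵐ ω ∂P, ∀ y, (P⟦{ω | Z (τ 0) ω = y}|𝓕 T ⊔ 𝓗 s⟧) ω = p s (τ 0) ω (Z s ω) y := by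
      rw [ae_all_iff]
      exact fun y => hp.transition s (τ 0) hs.1 (hsτ 0).1 (hsτ 0).2 y
    rw [hprod]
    calc P[(fun ω => g 0 (Z (τ 0) ω)) * R|𝓕 T ⊔ 𝓗 s]
        =ᵐ[P] P[P[(fun ω => g 0 (Z (τ 0) ω)) * R|𝓕 T ⊔ 𝓗 (τ 0)]|𝓕 T ⊔ 𝓗 s] :=
          (condExp_condExp_of_le hle' (hle _ ht)).symm
      _ =ᵐ[P] P[fun ω => g 0 (Z (τ 0) ω) * W (Z (τ 0) ω) ω|𝓕 T ⊔ 𝓗 s] :=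
          condExp_congr_ae hstep1
      _ =ᵐ[P] fun ω => ∑ y, g 0 y * W y ω * (P⟦{ω | Z (τ 0) ω = y}|𝓕 T ⊔ 𝓗 s⟧) ω :=
          condExp_comp_of_stronglyMeasurable (φ := fun y ω => g 0 y * W y ω)
            (hZ.measurable ht) hWi hWm
      _ =ᵐ[P] fun ω => pathWeight p (n + 1) s τ g (Z s ω) ω := by
          filter_upwards [htrans] with ω hω
          simp only [hω, pathWeight]
          exact Finset.sum_congr rfl fun y _ => mul_comm _ _

theorem IsCTransitionField.condExp_prod_terminal [IsFiniteMeasure P]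
    (hp : IsCTransitionField 𝓕 𝓗 T P Z p) (hZ : IsAdaptedCadlag T 𝓗 Z)
    (h𝓗 : MonotoneOn 𝓗 (Icc 0 T)) (hT : 0 ≤ T) {n : ℕ} {τ : Fin n → ℝ}
    (hτ : Monotone τ) (h0τ : ∀ i, 0 ≤ τ i ∧ τ i ≤ T) {g : Fin n → S → ℝ}
    (hg : ∀ i y, |g i y| ≤ 1) :
    P[fun ω => ∏ i, g i (Z (τ i) ω)|𝓕 T] =ᵐ[P]
      fun ω => ∑ z, pathWeight p n 0 τ g z ω * (P⟦{ω | Z 0 ω = z}|𝓕 T⟧) ω := by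
  have h0 : (0 : ℝ) ∈ Icc 0 T := ⟨le_rfl, hT⟩
  calc P[fun ω => ∏ i, g i (Z (τ i) ω)|𝓕 T]
      =ᵐ[P] P[P[fun ω => ∏ i, g i (Z (τ i) ω)|𝓕 T ⊔ 𝓗 0]|𝓕 T] :=
        (condExp_condExp_of_le le_sup_left (sup_le (𝓕.le T) (hZ.le 0 h0))).symm
    _ =ᵐ[P] P[fun ω => pathWeight p n 0 τ g (Z 0 ω) ω|𝓕 T] :=
        condExp_congr_ae (hp.condExp_prod hZ h𝓗 h0 hτ h0τ hg)
    _ =ᵐ[P] _ := condExp_comp_of_stronglyMeasurable (m := 𝓕 T) (hZ.measurable h0)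
        (hp.integrable_pathWeight le_rfl hτ h0τ hg) fun y =>
        (hp.measurable_pathWeight le_rfl hτ h0τ le_rfl g y).stronglyMeasurable

end FiniteDimensional

/-! ### Monotone class arguments -/

section PiSystem

/-- Both sides are finite signed measures in `A`. Two source spaces are allowed so that path laws
under different measures can be compared. -/
theorem setIntegral_preimage_eq_of_isPiSystem {Ω Ω' E : Type*} [MeasurableSpace Ω]
    [MeasurableSpace Ω'] {P : Measure Ω} {Q : Measure Ω'} {C : Set (Set E)} (hC : IsPiSystem C)
    {W : Ω → E} {V : Ω' → E}
    (hW : ∀ A, MeasurableSet[MeasurableSpace.generateFrom C] A → MeasurableSet (W ⁻¹' A))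
    (hV : ∀ A, MeasurableSet[MeasurableSpace.generateFrom C] A → MeasurableSet (V ⁻¹' A))
    {u : Ω → ℝ} {v : Ω' → ℝ} (hu : Integrable u P) (hv : Integrable v Q)
    (huniv : ∫ ω, u ω ∂P = ∫ ω, v ω ∂Q)
    (h : ∀ A ∈ C, ∫ ω in W ⁻¹' A, u ω ∂P = ∫ ω in V ⁻¹' A, v ω ∂Q) {A : Set E}
    (hA : MeasurableSet[MeasurableSpace.generateFrom C] A) :
    ∫ ω in W ⁻¹' A, u ω ∂P = ∫ ω in V ⁻¹' A, v ω ∂Q := by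
  induction A, hA using MeasurableSpace.induction_on_inter rfl hC with
  | empty => simp
  | basic A hA => exact h A hA
  | compl A hA ih =>
    rw [preimage_compl, preimage_compl, setIntegral_compl (hW A hA) hu,
      setIntegral_compl (hV A hA) hv, ih, huniv]
  | iUnion f hd hf ih =>
    rw [preimage_iUnion, preimage_iUnion,
      integral_iUnion (fun i => hW _ (hf i)) (fun i j hij => (hd hij).preimage W)
        hu.integrableOn,
      integral_iUnion (fun i => hV _ (hf i)) (fun i j hij => (hd hij).preimage V)
        hv.integrableOn]
    exact tsum_congr ih

theorem setIntegral_eq_of_isPiSystem {Ω : Type*} [mΩ : MeasurableSpace Ω] {P : Measure Ω}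
    {C : Set (Set Ω)} (hC : IsPiSystem C) (hCm : MeasurableSpace.generateFrom C ≤ mΩ)
    {u v : Ω → ℝ} (hu : Integrable u P) (hv : Integrable v P)
    (huniv : ∫ ω, u ω ∂P = ∫ ω, v ω ∂P)
    (h : ∀ A ∈ C, ∫ ω in A, u ω ∂P = ∫ ω in A, v ω ∂P) {A : Set Ω}
    (hA : MeasurableSet[MeasurableSpace.generateFrom C] A) :
    ∫ ω in A, u ω ∂P = ∫ ω in A, v ω ∂P :=
  setIntegral_preimage_eq_of_isPiSystem (W := id) (V := id) hC hCm hCm hu hv huniv h hA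

/-- The events that prescribe the values of the process `Z` at finitely many times of `I`. -/
def pointCylinders {ι Ω S : Type*} (Z : ι → Ω → S) (I : Set ι) : Set (Set Ω) :=
  {A | ∃ J : Finset ι, ↑J ⊆ I ∧ ∃ f : ι → S, A = {ω | ∀ t ∈ J, Z t ω = f t}}

variable {ι Ω S : Type*} {Z : ι → Ω → S} {I : Set ι}

theorem isPiSystem_pointCylinders : IsPiSystem (pointCylinders Z I) := by
  classical
  rintro _ ⟨J, hJ, f, rfl⟩ _ ⟨J', hJ', f', rfl⟩ ⟨ω₀, h₀, h₀'⟩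
  -- A point `ω₀` of the intersection provides one prescription compatible with both cylinders.
  refine ⟨J ∪ J', by rw [Finset.coe_union]; exact union_subset hJ hJ', fun t => Z t ω₀, ?_⟩
  ext ω
  simp only [mem_inter_iff, mem_ofPred_eq, Finset.mem_union]
  constructor
  · rintro ⟨h, h'⟩ t (ht | ht)
    · rw [h t ht]; exact (h₀ t ht).symm
    · rw [h' t ht]; exact (h₀' t ht).symm
  · exact fun h => ⟨fun t ht => (h t (Or.inl ht)).trans (h₀ t ht),
      fun t ht => (h t (Or.inr ht)).trans (h₀' t ht)⟩

variable [MeasurableSpace S]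

theorem measurableSet_of_mem_pointCylinders [MeasurableSingletonClass S] {m : MeasurableSpace Ω}
    (hZ : ∀ t ∈ I, Measurable[m] (Z t)) {A : Set Ω} (hA : A ∈ pointCylinders Z I) :
    MeasurableSet[m] A := by
  obtain ⟨J, hJ, f, rfl⟩ := hA
  have : {ω | ∀ t ∈ J, Z t ω = f t} = ⋂ t ∈ J, Z t ⁻¹' {f t} := by ext; simp
  rw [this]
  exact J.measurableSet_biInter fun t ht => hZ t (hJ ht) (measurableSet_singleton _)

theorem generateFrom_pointCylinders_le [MeasurableSingletonClass S] {m : MeasurableSpace Ω}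
    (hZ : ∀ t ∈ I, Measurable[m] (Z t)) :
    MeasurableSpace.generateFrom (pointCylinders Z I) ≤ m :=
  MeasurableSpace.generateFrom_le fun _ hA => measurableSet_of_mem_pointCylinders hZ hA

theorem measurable_generateFrom_pointCylinders [Countable S] {t : ι}
    (ht : t ∈ I) : Measurable[MeasurableSpace.generateFrom (pointCylinders Z I)] (Z t) := by
  refine @measurable_to_countable' _ _ _ _ (MeasurableSpace.generateFrom _) _ fun x => ?_
  refine MeasurableSpace.measurableSet_generateFrom ⟨{t}, by simpa using ht, fun _ => x, ?_⟩
  ext ω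
  simp

theorem history_le_generateFrom [Countable S] (Z : ℝ → Ω → S) (t : ℝ) :
    history Z t ≤ MeasurableSpace.generateFrom (pointCylinders Z (Icc 0 t)) :=
  iSup₂_le fun _ hs => (measurable_generateFrom_pointCylinders hs).comap_le

end PiSystem

/-! ### Conditional probabilities and π-systems -/

section CondExpSet

variable {Ω : Type*} {m M m' : MeasurableSpace Ω} [mΩ : MeasurableSpace Ω] {P : Measure Ω}
  [IsFiniteMeasure P]

/-- Moves `A` from the conditional probability into the domain of integration. Identities between
conditional probabilities thereby become identities between signed measures in `A`, accessible to
π-λ arguments. -/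
theorem integral_condExp_indicator_mul (hm : m ≤ mΩ) {A : Set Ω} (hA : MeasurableSet A)
    {G : Ω → ℝ} (hG : AEStronglyMeasurable[m] G P) (hGi : Integrable G P) {F : Set Ω}
    (hF : MeasurableSet[m] F) :
    ∫ ω in F, (P⟦A|m⟧) ω * G ω ∂P = ∫ ω in A, F.indicator G ω ∂P := by
  have h1 : (A.indicator fun _ => (1 : ℝ)) * G = A.indicator G := by
    ext ω; by_cases h : ω ∈ A <;> simp [h]
  have h2 : P[(A.indicator fun _ => (1 : ℝ)) * G|m] =ᵐ[P] P⟦A|m⟧ * G :=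
    condExp_mul_of_aestronglyMeasurable_right hG (by rw [h1]; exact hGi.indicator hA)
      (integrable_indicator_one hA)
  change ∫ ω in F, (P⟦A|m⟧ * G) ω ∂P = _
  rw [setIntegral_congr_ae (hm _ hF) (h2.symm.mono fun _ h _ => h), h1,
    setIntegral_condExp hm (hGi.indicator hA) hF, setIntegral_indicator hA,
    setIntegral_indicator (hm _ hF), inter_comm]

theorem setIntegral_condExp_indicator (hm : m ≤ mΩ) {A F : Set Ω} (hA : MeasurableSet A)
    (hF : MeasurableSet[m] F) :
    ∫ ω in F, (P⟦A|m⟧) ω ∂P = ∫ ω in A, F.indicator (fun _ => (1 : ℝ)) ω ∂P := by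
  rw [← integral_condExp_indicator_mul hm hA aestronglyMeasurable_const (integrable_const 1) hF]
  simp only [mul_one]

theorem setIntegral_condExp_indicator_comm (hm : m ≤ mΩ) {A B : Set Ω} (hA : MeasurableSet A)
    (hB : MeasurableSet B) :
    ∫ ω in A, (P⟦B|m⟧) ω ∂P = ∫ ω in B, (P⟦A|m⟧) ω ∂P := by
  have h : ∀ {A B : Set Ω}, MeasurableSet A → MeasurableSet B →
      ∫ ω in A, (P⟦B|m⟧) ω ∂P = ∫ ω, (P⟦A|m⟧) ω * (P⟦B|m⟧) ω ∂P := fun hA hB => by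
    rw [← setIntegral_univ (f := fun ω => _ * _), integral_condExp_indicator_mul hm hA
      stronglyMeasurable_condExp.aestronglyMeasurable integrable_condExp MeasurableSet.univ,
      indicator_univ]
  rw [h hA hB, h hB hA]
  simp only [mul_comm]

/-- For fixed `F` in `M`, self-adjointness of conditional expectation turns both sides, integrated
over `F`, into integrals over `A` of functions independent of `A`. -/
theorem condExp_indicator_eq_of_isPiSystem (hm : m ≤ M) (hM : M ≤ mΩ) {C : Set (Set Ω)}
    (hC : IsPiSystem C) (hCm : MeasurableSpace.generateFrom C ≤ mΩ)
    (h : ∀ A ∈ C, P⟦A|M⟧ =ᵐ[P] P⟦A|m⟧) {A : Set Ω}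
    (hA : MeasurableSet[MeasurableSpace.generateFrom C] A) : P⟦A|M⟧ =ᵐ[P] P⟦A|m⟧ := by
  have hAm := hCm _ hA
  refine (ae_eq_condExp_of_forall_setIntegral_eq hM (integrable_indicator_one hAm)
    (fun _ _ _ => integrable_condExp.integrableOn) (fun F hF _ => ?_)
    (stronglyMeasurable_condExp.mono hm).aestronglyMeasurable).symm
  have hFm := hM _ hF
  have key : ∀ B, MeasurableSet B → (∫ ω in F, (P⟦B|m⟧) ω ∂P = ∫ ω in F, (P⟦B|M⟧) ω ∂P ↔
      ∫ ω in B, (P⟦F|m⟧) ω ∂P = ∫ ω in B, F.indicator (fun _ => (1 : ℝ)) ω ∂P) := by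
    intro B hB
    rw [setIntegral_condExp_indicator_comm (hm.trans hM) hFm hB,
      setIntegral_condExp_indicator hM hB hF]
  rw [← setIntegral_condExp hM (integrable_indicator_one hAm) hF, key A hAm]
  refine setIntegral_eq_of_isPiSystem hC hCm integrable_condExp (integrable_indicator_one hFm)
    (integral_condExp (hm.trans hM)) (fun B hB => ?_) hA
  have hBm := hCm _ (MeasurableSpace.measurableSet_generateFrom hB)
  exact (key B hBm).1 (setIntegral_congr_ae hFm ((h B hB).symm.mono fun _ h _ => h))

/-- If the conditional probabilities given `M` of the events of `m'` are `m`-measurable, then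
enlarging `m` by `m'` does not change the conditional expectations of `M`-measurable variables. -/
theorem condExp_sup_eq_of_condExp_indicator_eq (hm : m ≤ M)
    (hM : M ≤ mΩ) (hm' : m' ≤ mΩ)
    (h : ∀ B, MeasurableSet[m'] B → P⟦B|M⟧ =ᵐ[P] P⟦B|m⟧) {φ : Ω → ℝ}
    (hφ : StronglyMeasurable[M] φ) (hφi : Integrable φ P) : P[φ|m ⊔ m'] =ᵐ[P] P[φ|m] := by
  have hmΩ := hm.trans hM
  refine (ae_eq_condExp_of_forall_setIntegral_eq (sup_le hmΩ hm') hφi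
    (fun _ _ _ => integrable_condExp.integrableOn) (fun A hA _ => ?_)
    (stronglyMeasurable_condExp.mono (le_sup_left : m ≤ m ⊔ m')).aestronglyMeasurable).symm
  set C : Set (Set Ω) :=
    {A | ∃ F B, MeasurableSet[m] F ∧ MeasurableSet[m'] B ∧ A = F ∩ B} with hCdef
  have hC : IsPiSystem C := by
    rintro _ ⟨F, B, hF, hB, rfl⟩ _ ⟨F', B', hF', hB', rfl⟩ _
    exact ⟨F ∩ F', B ∩ B', @MeasurableSet.inter _ m _ _ hF hF',
      @MeasurableSet.inter _ m' _ _ hB hB', inter_inter_inter_comm _ _ _ _⟩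
  have hCle : MeasurableSpace.generateFrom C ≤ mΩ := by
    refine MeasurableSpace.generateFrom_le ?_
    rintro _ ⟨F, B, hF, hB, rfl⟩
    exact (hmΩ _ hF).inter (hm' _ hB)
  have hle : m ⊔ m' ≤ MeasurableSpace.generateFrom C := by
    refine sup_le (fun F hF => ?_) (fun B hB => ?_)
    · exact MeasurableSpace.measurableSet_generateFrom
        ⟨F, univ, hF, @MeasurableSet.univ _ m', (inter_univ F).symm⟩
    · exact MeasurableSpace.measurableSet_generateFrom
        ⟨univ, B, @MeasurableSet.univ _ m, hB, (univ_inter B).symm⟩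
  refine setIntegral_eq_of_isPiSystem hC hCle integrable_condExp hφi (integral_condExp hmΩ)
    ?_ (hle _ hA)
  rintro _ ⟨F, B, hF, hB, rfl⟩
  have hBm := hm' _ hB
  have hmul : Integrable (P⟦B|m⟧ * φ) P := by
    refine hφi.bdd_mul (c := 1) integrable_condExp.aestronglyMeasurable ?_
    filter_upwards [ae_condExp_indicator_mem_Icc (m := m) (P := P) B hBm] with ω hω
    rw [Real.norm_eq_abs, abs_of_nonneg hω.1]
    exact hω.2
  -- Over `F ∩ B`, the integral of `P[φ|m]` is that of `P⟦B|m⟧ * P[φ|m]` over `F`, hence of `P⟦B|m⟧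
  -- * φ`. By hypothesis this equals the integral of `P⟦B|M⟧ * φ` over `F`, which is that of `φ`
  -- over `F ∩ B`.
  rw [inter_comm, ← setIntegral_indicator (hmΩ _ hF), ← setIntegral_indicator (hmΩ _ hF),
    ← integral_condExp_indicator_mul hmΩ hBm stronglyMeasurable_condExp.aestronglyMeasurable
      integrable_condExp hF,
    ← integral_condExp_indicator_mul hM hBm hφ.aestronglyMeasurable hφi (hm _ hF)]
  have h2 : P[P⟦B|m⟧ * φ|m] =ᵐ[P] P⟦B|m⟧ * P[φ|m] :=
    condExp_mul_of_stronglyMeasurable_left stronglyMeasurable_condExp hmul hφi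
  have h3 : ∫ ω in F, (P⟦B|M⟧) ω * φ ω ∂P = ∫ ω in F, (P⟦B|m⟧ * φ) ω ∂P :=
    setIntegral_congr_ae (hmΩ _ hF) ((h B hB).mono fun ω hω _ => by rw [Pi.mul_apply, hω])
  rw [h3, ← setIntegral_condExp hmΩ hmul hF]
  exact setIntegral_congr_ae (hmΩ _ hF) (h2.symm.mono fun _ h _ => h)

/-- Conditional independence is inherited from π-systems by the generated sigma-algebras. -/
theorem condExp_iInter_eq_prod_of_isPiSystem {ι : Type*} [Fintype ι] (hm : m ≤ mΩ)
    {C : ι → Set (Set Ω)} (hC : ∀ i, IsPiSystem (C i))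
    (hCm : ∀ i, MeasurableSpace.generateFrom (C i) ≤ mΩ)
    (h : ∀ A : ι → Set Ω, (∀ i, A i ∈ C i) → P⟦⋂ i, A i|m⟧ =ᵐ[P] ∏ i, P⟦A i|m⟧)
    (huniv : ∀ i, univ ∈ C i)
    {A : ι → Set Ω} (hA : ∀ i, MeasurableSet[MeasurableSpace.generateFrom (C i)] (A i)) :
    P⟦⋂ i, A i|m⟧ =ᵐ[P] ∏ i, P⟦A i|m⟧ := by
  classical
  -- The events with index in `u` are already general; those outside are still in the π-systems. One
  -- index is released at a time.
  have main : ∀ (u : Finset ι) (A : ι → Set Ω),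
      (∀ i, MeasurableSet[MeasurableSpace.generateFrom (C i)] (A i)) → (∀ i ∉ u, A i ∈ C i) →
      P⟦⋂ i, A i|m⟧ =ᵐ[P] ∏ i, P⟦A i|m⟧ := by
    intro u
    induction u using Finset.induction_on with
    | empty => exact fun A _ hA => h A fun i => hA i (Finset.notMem_empty i)
    | insert j u hj ih =>
      intro A hA hAu
      have hAm : ∀ i, MeasurableSet (A i) := fun i => hCm i _ (hA i)
      set D : Set Ω := ⋂ i ∈ Finset.univ.erase j, A i with hD
      have hDm : MeasurableSet D := Finset.measurableSet_biInter _ fun i _ => hAm i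
      set G : Ω → ℝ := ∏ i ∈ Finset.univ.erase j, P⟦A i|m⟧ with hG
      have hGm : StronglyMeasurable[m] G :=
        Finset.stronglyMeasurable_prod _ fun i _ => stronglyMeasurable_condExp
      have hbound : ∀ (s : Finset ι) (A : ι → Set Ω), (∀ i, MeasurableSet (A i)) →
          Integrable (∏ i ∈ s, P⟦A i|m⟧) P := by
        intro s A hA
        refine Integrable.of_bound ((Finset.stronglyMeasurable_prod (m := m) _ fun i _ =>
          stronglyMeasurable_condExp).mono hm).aestronglyMeasurable 1 ?_
        have hall : ∀ᵐ ω ∂P, ∀ i, (P⟦A i|m⟧) ω ∈ Icc (0 : ℝ) 1 :=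
          ae_all_iff.2 fun i => ae_condExp_indicator_mem_Icc _ (hA i)
        filter_upwards [hall] with ω hω
        rw [Real.norm_eq_abs, Finset.prod_apply, Finset.abs_prod]
        exact Finset.prod_le_one (fun _ _ => abs_nonneg _) fun i _ => by
          rw [abs_of_nonneg (hω i).1]; exact (hω i).2
      have hGi : Integrable G P := hbound _ A hAm
      -- With all other events frozen, the desired identity integrated over `F` equates two signed
      -- measures evaluated at the j-th event `B`.
      have key : ∀ (F B : Set Ω), MeasurableSet[m] F → MeasurableSet B →
          (∫ ω in F, (∏ i, P⟦Function.update A j B i|m⟧) ω ∂P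
            = ∫ ω in F, ((⋂ i, Function.update A j B i).indicator fun _ => (1 : ℝ)) ω ∂P ↔
          ∫ ω in B, F.indicator G ω ∂P
            = ∫ ω in B, (F ∩ D).indicator (fun _ => (1 : ℝ)) ω ∂P) := by
        intro F B hF hB
        have h1 : ∏ i, P⟦Function.update A j B i|m⟧ = P⟦B|m⟧ * G := by
          rw [← Finset.mul_prod_erase _ _ (Finset.mem_univ j), Function.update_self]
          congr 1
          exact Finset.prod_congr rfl fun i hi => by
            rw [Function.update_of_ne (Finset.ne_of_mem_erase hi)]
        have h2 : ⋂ i, Function.update A j B i = D ∩ B := by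
          ext ω
          simp only [mem_iInter, hD, mem_inter_iff, Finset.mem_erase, Finset.mem_univ, and_true]
          constructor
          · exact fun h => ⟨fun i hi => by simpa [Function.update_of_ne hi] using h i,
              by simpa using h j⟩
          · rintro ⟨h, h'⟩ i
            rcases eq_or_ne i j with rfl | hi
            · simpa using h'
            · simpa [Function.update_of_ne hi] using h i hi
        rw [h1, h2, setIntegral_indicator (hDm.inter hB),
          setIntegral_indicator ((hm _ hF).inter hDm), inter_comm B, inter_assoc,
          ← integral_condExp_indicator_mul hm hB hGm.aestronglyMeasurable hGi hF]
        rfl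
      refine (ae_eq_condExp_of_forall_setIntegral_eq hm
        (integrable_indicator_one (MeasurableSet.iInter hAm))
        (fun _ _ _ => (hbound _ A hAm).integrableOn) (fun F hF _ => ?_)
        (Finset.stronglyMeasurable_prod _ fun i _ =>
          stronglyMeasurable_condExp).aestronglyMeasurable).symm
      have hself : A = Function.update A j (A j) := (Function.update_eq_self j A).symm
      rw [hself, key F (A j) hF (hAm j)]
      have hC' : ∀ B ∈ C j, ∫ ω in B, F.indicator G ω ∂P
            = ∫ ω in B, (F ∩ D).indicator (fun _ => (1 : ℝ)) ω ∂P := by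
        intro B hB
        have hBg := MeasurableSpace.measurableSet_generateFrom hB
        have hupd : ∀ i, MeasurableSet[MeasurableSpace.generateFrom (C i)]
            (Function.update A j B i) := fun i => by
          rcases eq_or_ne i j with rfl | hi
          · simpa using hBg
          · simpa [Function.update_of_ne hi] using hA i
        refine (key F B hF (hCm j _ hBg)).1 ?_
        rw [← setIntegral_congr_ae (hm _ hF) ((ih (Function.update A j B) hupd
          fun i hi => ?_).mono fun _ h _ => h)]
        · exact setIntegral_condExp hm (integrable_indicator_one
            (MeasurableSet.iInter fun i => hCm i _ (hupd i))) hF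
        · rcases eq_or_ne i j with rfl | hij
          · simpa using hB
          · simpa [Function.update_of_ne hij] using
              hAu i (by simp [Finset.mem_insert, hij, hi])
      refine setIntegral_eq_of_isPiSystem (hC j) (hCm j) (hGi.indicator (hm _ hF))
        (integrable_indicator_one ((hm _ hF).inter hDm)) ?_ hC' (hA j)
      simpa using hC' univ (huniv j)
  exact main Finset.univ A hA fun i hi => absurd (Finset.mem_univ i) hi

end CondExpSet

/-! ### The filtration generated by a process -/

section GeneratedFiltration

variable {Ω S : Type*} {m : MeasurableSpace Ω} [mΩ : MeasurableSpace Ω] [MeasurableSpace S]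
  {T : ℝ} {P : Measure Ω} {X : ℝ → Ω → S}

theorem history_le (hX : ∀ t ∈ Icc 0 T, Measurable (X t)) {t : ℝ} (ht : t ≤ T) :
    history X t ≤ mΩ :=
  iSup₂_le fun _ hs => (hX _ ⟨hs.1, hs.2.trans ht⟩).comap_le

theorem generatedFiltration_le (hX : ∀ t ∈ Icc 0 T, Measurable (X t)) (t : ℝ) :
    generatedFiltration T P X t ≤ mΩ :=
  sup_le ((iInf₂_le (t + 1) (mem_Ioi.2 (lt_add_one t))).trans (history_le hX (min_le_right _ _)))
    (MeasurableSpace.generateFrom_le fun _ hA => hA.1)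

theorem generatedFiltration_mono : Monotone (generatedFiltration T P X) := fun _ _ hst =>
  sup_le_sup_right (biInf_mono fun _ hu => lt_of_le_of_lt hst hu) _

theorem stateSigma_le_generatedFiltration {s t : ℝ} (hs : s ∈ Icc 0 t) (ht : t ≤ T) :
    stateSigma X s ≤ generatedFiltration T P X t :=
  le_sup_of_le_left <| le_iInf₂ fun _ hu => le_iSup₂_of_le s
    ⟨hs.1, le_min (hs.2.trans (le_of_lt hu)) (hs.2.trans ht)⟩ le_rfl

theorem generatedFiltration_le_eventuallyMeasurableSpace {t : ℝ}
    (h : ⨅ u ∈ Ioi t, history X (min u T) ≤ m) :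
    generatedFiltration T P X t ≤ eventuallyMeasurableSpace m (ae P) :=
  sup_le (h.trans le_eventuallyMeasurableSpace) <| MeasurableSpace.generateFrom_le fun _ hA =>
    ⟨∅, @MeasurableSet.empty _ m, ae_eq_empty.2 hA.2⟩

theorem isAdaptedCadlag_generatedFiltration (hX : ∀ t ∈ Icc 0 T, Measurable (X t))
    (hc : IsCadlagOn T X) : IsAdaptedCadlag T (generatedFiltration T P X) X where
  le t _ := generatedFiltration_le hX t
  adapted _ ht := measurable_iff_comap_le.2 <|
    stateSigma_le_generatedFiltration ⟨ht.1, le_rfl⟩ ht.2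
  cadlag := hc

/-- Before `T` this is right-continuity of `𝓖`. At `T` the truncation `min u T` makes the
intersection just the history up to `T`. -/
theorem iInf_history_le {𝓖 : Filtration ℝ mΩ} (h𝓖 : IsRightContinuousOn T 𝓖)
    (hX : ∀ t ∈ Icc 0 T, Measurable[𝓖 t] (X t)) {t : ℝ} (ht : t ∈ Icc 0 T) :
    ⨅ u ∈ Ioi t, history X (min u T) ≤ 𝓖 t := by
  have hle : ∀ u ≤ T, history X u ≤ 𝓖 u := fun u hu => iSup₂_le fun s hs =>
    (hX s ⟨hs.1, hs.2.trans hu⟩).comap_le.trans (𝓖.mono hs.2)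
  rcases ht.2.eq_or_lt with rfl | htT
  · refine (iInf₂_le (t + 1) (mem_Ioi.2 (lt_add_one t))).trans ?_
    rw [min_eq_right (lt_add_one t).le]
    exact hle t le_rfl
  · refine le_trans (le_iInf₂ fun u hu => ?_) (h𝓖 t ⟨ht.1, htT⟩)
    refine (iInf₂_le u (mem_Ioi.2 hu.1)).trans ?_
    rw [min_eq_left hu.2]
    exact hle u hu.2

theorem sup_le_eventuallyMeasurableSpace {Ω : Type*} {m₀ m m' : MeasurableSpace Ω}
    [MeasurableSpace Ω] {P : Measure Ω}
    (h : m' ≤ eventuallyMeasurableSpace m (ae P)) :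
    m₀ ⊔ m' ≤ eventuallyMeasurableSpace (m₀ ⊔ m) (ae P) := by
  refine sup_le (le_sup_left.trans le_eventuallyMeasurableSpace) fun A hA => ?_
  obtain ⟨B, hB, hAB⟩ := h A hA
  exact ⟨B, (le_sup_right : m ≤ m₀ ⊔ m) _ hB, hAB⟩

variable {𝓕 : Filtration ℝ mΩ}

/-- A variable that is measurable, up to null sets, with respect to `𝓕 u` for all `u > t` is so
with respect to `𝓕 t`. -/
theorem IsRightContinuousOn.aestronglyMeasurable (h𝓕 : IsRightContinuousOn T 𝓕) {t : ℝ}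
    (ht : t ∈ Ico 0 T) {f : Ω → ℝ} (hf : ∀ u ∈ Ioc t T, AEStronglyMeasurable[𝓕 u] f P) :
    AEStronglyMeasurable[𝓕 t] f P := by
  obtain ⟨u, hu, huT, hulim⟩ := exists_seq_strictAnti_tendsto' ht.2
  have hu' : ∀ n, u n ∈ Ioc t T := fun n => ⟨(huT n).1, (huT n).2.le⟩
  choose g hg hfg using fun n => hf (u n) (hu' n)
  -- The limsup ignores finitely many terms, so `G` is measurable for every `𝓕 (u m)` and therefore
  -- for their intersection.
  set G : Ω → ℝ := fun ω => limsup (fun n => g n ω) atTop with hG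
  have hGm : ∀ m, Measurable[𝓕 (u m)] G := by
    intro m
    have h1 : G = fun ω => limsup (fun n => g (n + m) ω) atTop :=
      funext fun ω => (limsup_nat_add (fun n => g n ω) m).symm
    rw [h1]
    exact Measurable.limsup fun n => ((hg (n + m)).mono
      (𝓕.mono (hu.antitone (Nat.le_add_left m n)))).measurable
  have hGt : Measurable[𝓕 t] G := by
    intro s hs
    refine h𝓕 t ht _ ?_
    rw [MeasurableSpace.measurableSet_iInf]
    intro v
    rw [MeasurableSpace.measurableSet_iInf]
    intro hv
    obtain ⟨n, hn⟩ := (hulim.eventually_lt_const hv.1).exists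
    exact 𝓕.mono hn.le _ (hGm n hs)
  refine ⟨G, hGt.stronglyMeasurable, ?_⟩
  filter_upwards [ae_all_iff.2 hfg] with ω hω
  simp only [hG, ← hω, limsup_const]

variable [IsFiniteMeasure P] [MeasurableSingletonClass S] [Countable S]

/-- If the conditional law of the past of `X` given `𝓕 T` is adapted, then this extends to the
completed right-continuous filtration generated by `X`. -/
theorem condExp_indicator_generatedFiltration (h𝓕 : IsRightContinuousOn T 𝓕)
    (hX : ∀ t ∈ Icc 0 T, Measurable (X t))
    (h : ∀ u ∈ Icc 0 T, ∀ B ∈ pointCylinders X (Icc 0 u), P⟦B|𝓕 T⟧ =ᵐ[P] P⟦B|𝓕 u⟧)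
    {t : ℝ} (ht : t ∈ Icc 0 T) {B : Set Ω} (hB : MeasurableSet[generatedFiltration T P X t] B) :
    P⟦B|𝓕 T⟧ =ᵐ[P] P⟦B|𝓕 t⟧ := by
  rcases ht.2.eq_or_lt with rfl | htT
  · rfl
  -- Up to a null set, `B` lies in the history up to every `u > t`. Its conditional probability is
  -- thus `𝓕 u`-measurable modulo null sets for all such `u`, and right-continuity brings this down
  -- to `t`.
  obtain ⟨A, hA, hBA⟩ := generatedFiltration_le_eventuallyMeasurableSpace
    (m := ⨅ u ∈ Ioi t, history X (min u T)) (P := P) le_rfl B hB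
  have hAu : ∀ u ∈ Ioc t T, MeasurableSet[history X u] A := by
    intro u hu
    have h1 := (iInf₂_le u (mem_Ioi.2 hu.1) : ⨅ u ∈ Ioi t, history X (min u T) ≤ _) A hA
    rwa [min_eq_left hu.2] at h1
  have hAm : MeasurableSet A := history_le hX le_rfl A (hAu T ⟨htT, le_rfl⟩)
  have hind : (B.indicator fun _ => (1 : ℝ)) =ᵐ[P] A.indicator fun _ => (1 : ℝ) :=
    indicator_ae_eq_of_ae_eq_set hBA
  have hmain : P⟦A|𝓕 T⟧ =ᵐ[P] P⟦A|𝓕 t⟧ := by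
    have hmeas : AEStronglyMeasurable[𝓕 t] (P⟦A|𝓕 T⟧) P := by
      refine h𝓕.aestronglyMeasurable ⟨ht.1, htT⟩ fun u hu => ?_
      have hu0 : u ∈ Icc 0 T := ⟨ht.1.trans hu.1.le, hu.2⟩
      refine ⟨P⟦A|𝓕 u⟧, stronglyMeasurable_condExp, ?_⟩
      exact condExp_indicator_eq_of_isPiSystem (𝓕.mono hu.2) (𝓕.le T) isPiSystem_pointCylinders
        (generateFrom_pointCylinders_le fun s hs => hX s ⟨hs.1, hs.2.trans hu.2⟩) (h u hu0)
        (history_le_generateFrom X u _ (hAu u hu))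
    exact (condExp_ae_eq_of_le (𝓕.le T) (𝓕.mono ht.2) (integrable_indicator_one hAm)
      (ae_eq_refl _) hmeas).symm
  exact (condExp_congr_ae hind).trans (hmain.trans (condExp_congr_ae hind).symm)

end GeneratedFiltration

/-! ### From transition fields to the Markov properties -/

section Markov

theorem stronglyMeasurable_comp_state {Ω S : Type*} [Fintype S] [MeasurableSpace S]
    [MeasurableSingletonClass S] {m m' : MeasurableSpace Ω}
    {Z : Ω → S} (hZ : Measurable[m'] Z) {φ : S → Ω → ℝ} (hφ : ∀ y, StronglyMeasurable[m] (φ y)) :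
    StronglyMeasurable[m ⊔ m'] fun ω => φ (Z ω) ω := by
  rw [comp_eq_sum_mul_indicator φ Z]
  exact Finset.stronglyMeasurable_sum _ fun y _ => ((hφ y).mono le_sup_left).mul
    (stronglyMeasurable_const.indicator ((le_sup_right : m' ≤ m ⊔ m') _
      (hZ (measurableSet_singleton y))))

theorem stateSigma_le {Ω S : Type*} [mΩ : MeasurableSpace Ω] [MeasurableSpace S]
    {𝓗 : ℝ → MeasurableSpace Ω} {T : ℝ} {Z : ℝ → Ω → S}
    (hZ : IsAdaptedCadlag T 𝓗 Z) {t : ℝ} (ht : t ∈ Icc 0 T) :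
    stateSigma Z t ≤ 𝓗 t :=
  (hZ.adapted t ht).comap_le

variable {Ω S : Type*} [Fintype S] [mΩ : MeasurableSpace Ω] [MeasurableSpace S]
  {𝓕 : Filtration ℝ mΩ} {𝓖 𝓗 : ℝ → MeasurableSpace Ω} {T : ℝ} {P : Measure Ω} {Z : ℝ → Ω → S}
  {p : ℝ → ℝ → Ω → Matrix S S ℝ}

variable [IsFiniteMeasure P] [MeasurableSingletonClass S]

/-- The conditional probability given the large sigma-algebra is already measurable for `𝓕 t ⊔
stateSigma Z s`, so conditioning on the latter changes nothing. -/
theorem IsCTransitionField.isDSMC (hp : IsCTransitionField 𝓕 𝓗 T P Z p)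
    (hZ : IsAdaptedCadlag T 𝓗 Z) : IsDSMC 𝓕 𝓗 T P Z where
  process := hZ
  markov s t y hs hst ht := by
    have hs' : s ∈ Icc 0 T := ⟨hs, hst.trans ht⟩
    have h1 := hp.transition s t hs hst ht y
    refine h1.trans (condExp_ae_eq_of_le (sup_le (𝓕.le T) (hZ.le s hs'))
      (sup_le_sup (𝓕.mono ht) (stateSigma_le hZ hs'))
      (integrable_indicator_one (hZ.measurable ⟨hs.trans hst, ht⟩ (measurableSet_singleton y))) h1
      (stronglyMeasurable_comp_state (m := 𝓕 t) (φ := fun x ω => p s t ω x y)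
        (comap_measurable (Z s)) fun x =>
        (hp.measurable s t hs hst ht x y).stronglyMeasurable).aestronglyMeasurable).symm

/-- Transition fields pass to smaller filtrations to which the process is adapted, up to null
sets. -/
theorem IsCTransitionField.of_le (hp : IsCTransitionField 𝓕 𝓖 T P Z p)
    (h𝓖 : ∀ t ∈ Icc 0 T, 𝓖 t ≤ mΩ) (hZ : IsAdaptedCadlag T 𝓗 Z)
    (hle : ∀ t ∈ Icc 0 T, 𝓗 t ≤ eventuallyMeasurableSpace (𝓖 t) (ae P)) :
    IsCTransitionField 𝓕 𝓗 T P Z p where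
  measurable := hp.measurable
  stochastic := hp.stochastic
  transition s t hs hst ht y := by
    have hs' : s ∈ Icc 0 T := ⟨hs, hst.trans ht⟩
    exact condExp_ae_eq_of_le_eventuallyMeasurableSpace (sup_le (𝓕.le T) (h𝓖 s hs'))
      (sup_le (𝓕.le T) (hZ.le s hs')) (sup_le_eventuallyMeasurableSpace (hle s hs'))
      (integrable_indicator_one (hZ.measurable ⟨hs.trans hst, ht⟩ (measurableSet_singleton y)))
      (hp.transition s t hs hst ht y)
      ((stronglyMeasurable_comp_state (m := 𝓕 T) (φ := fun x ω => p s t ω x y)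
        (hZ.adapted s hs') fun x => ((hp.measurable s t hs hst ht x y).mono
          (𝓕.mono ht) le_rfl).stronglyMeasurable).aestronglyMeasurable)

/-- A doubly stochastic Markov chain is a conditional Markov chain if its past does not help to
predict `𝓕 T`. -/
theorem IsCTransitionField.isCMC (hp : IsCTransitionField 𝓕 𝓗 T P Z p)
    (hZ : IsAdaptedCadlag T 𝓗 Z) (h𝓗 : MonotoneOn 𝓗 (Icc 0 T))
    (himm : ∀ t ∈ Icc 0 T, ∀ B, MeasurableSet[𝓗 t] B → P⟦B|𝓕 T⟧ =ᵐ[P] P⟦B|𝓕 t⟧) :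
    IsCMC 𝓕 𝓗 T P Z where
  process := hZ
  markov n t τ x ht htT hτ htτ := by
    classical
    have ht' : t ∈ Icc 0 T := ⟨ht, htT⟩
    set g : Fin n → S → ℝ := fun i y => if y = x i then 1 else 0 with hgdef
    have hg : ∀ i y, |g i y| ≤ 1 := by
      intro i y
      by_cases h : y = x i <;> simp [hgdef, h]
    have hind : ({ω | ∀ i, Z (τ i) ω = x i}.indicator fun _ => (1 : ℝ))
        = fun ω => ∏ i, g i (Z (τ i) ω) := by
      ext ω
      simp [hgdef, indicator_apply, Finset.prod_ite_zero]
    have hτ0 : ∀ i, 0 ≤ τ i ∧ τ i ≤ T := fun i => ⟨ht.trans (htτ i).1, (htτ i).2⟩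
    have hi : Integrable (fun ω => ∏ i, g i (Z (τ i) ω)) P := integrable_prod_comp hZ hτ0 hg
    set W : S → Ω → ℝ := pathWeight p n t τ g with hW
    have hWi : ∀ y, Integrable (W y) P := hp.integrable_pathWeight ht hτ htτ hg
    have hZm : Measurable[𝓕 t ⊔ 𝓗 t] (Z t) := (hZ.adapted t ht').mono le_sup_right le_rfl
    have hleT : 𝓕 T ⊔ 𝓗 t ≤ mΩ := sup_le (𝓕.le T) (hZ.le t ht')
    have hlet : 𝓕 t ⊔ 𝓗 t ≤ mΩ := sup_le (𝓕.le t) (hZ.le t ht')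
    -- The weight of the future is `𝓕 T`-measurable; by `himm` the past in `𝓗 t` carries no further
    -- information on it.
    have hall : ∀ᵐ ω ∂P, ∀ y, P[W y|𝓕 t ⊔ 𝓗 t] ω = P[W y|𝓕 t] ω := ae_all_iff.2 fun y =>
      condExp_sup_eq_of_condExp_indicator_eq (𝓕.mono htT) (𝓕.le T) (hZ.le t ht') (himm t ht')
        (hp.measurable_pathWeight ht hτ htτ le_rfl g y).stronglyMeasurable (hWi y)
    rw [hind]
    have key : P[fun ω => ∏ i, g i (Z (τ i) ω)|𝓕 t ⊔ 𝓗 t] =ᵐ[P]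
        fun ω => P[W (Z t ω)|𝓕 t] ω := by
      calc P[fun ω => ∏ i, g i (Z (τ i) ω)|𝓕 t ⊔ 𝓗 t]
          =ᵐ[P] P[P[fun ω => ∏ i, g i (Z (τ i) ω)|𝓕 T ⊔ 𝓗 t]|𝓕 t ⊔ 𝓗 t] :=
            (condExp_condExp_of_le (sup_le_sup_right (𝓕.mono htT) _) hleT).symm
        _ =ᵐ[P] P[fun ω => W (Z t ω) ω|𝓕 t ⊔ 𝓗 t] :=
            condExp_congr_ae (hp.condExp_prod hZ h𝓗 ht' hτ htτ hg)
        _ =ᵐ[P] fun ω => P[W (Z t ω)|𝓕 t ⊔ 𝓗 t] ω := condExp_comp_of_measurable hlet hZm hWi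
        _ =ᵐ[P] fun ω => P[W (Z t ω)|𝓕 t] ω := hall.mono fun ω h => h _
    exact key.trans (condExp_ae_eq_of_le hlet (sup_le_sup_left (stateSigma_le hZ ht') _) hi key
      (stronglyMeasurable_comp_state (m := 𝓕 t) (φ := fun y => P[W y|𝓕 t])
        (comap_measurable (Z t)) fun y => stronglyMeasurable_condExp).aestronglyMeasurable).symm

end Markov

/-! ### Conditional laws on path space -/

section PathLaw

variable {Ω : Type*} {m : MeasurableSpace Ω} [mΩ : MeasurableSpace Ω] {P Q : Measure Ω}

theorem ae_eq_of_trim_absolutelyContinuous (hm : m ≤ mΩ) (hPQ : P.trim hm ≪ Q.trim hm)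
    {f g : Ω → ℝ} (hf : StronglyMeasurable[m] f) (hg : StronglyMeasurable[m] g)
    (h : f =ᵐ[Q] g) : f =ᵐ[P] g :=
  ae_eq_of_ae_eq_trim (hPQ.ae_eq (hf.ae_eq_trim_of_stronglyMeasurable hm hg h))

variable [IsFiniteMeasure P] [IsFiniteMeasure Q]

/-- Change of measure on a sub-sigma-algebra. -/
theorem exists_density_of_trim_absolutelyContinuous (hm : m ≤ mΩ)
    (hPQ : P.trim hm ≪ Q.trim hm) :
    ∃ D : Ω → ℝ, StronglyMeasurable[m] D ∧ Integrable D Q ∧ ∀ f : Ω → ℝ, StronglyMeasurable[m] f →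
      ∀ F, MeasurableSet[m] F → ∫ ω in F, f ω ∂P = ∫ ω in F, D ω * f ω ∂Q := by
  set D : Ω → ℝ := fun ω => ((P.trim hm).rnDeriv (Q.trim hm) ω).toReal with hD
  have hDm : StronglyMeasurable[m] D :=
    (Measure.measurable_rnDeriv (P.trim hm) (Q.trim hm)).ennreal_toReal.stronglyMeasurable
  refine ⟨D, hDm, integrable_of_integrable_trim hm Measure.integrable_toReal_rnDeriv,
    fun f hf F hF => ?_⟩
  have h1 := setIntegral_trim hm hf hF (μ := P)
  have h2 := setIntegral_trim hm (hDm.mul hf) hF (μ := Q)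
  have h3 := setIntegral_rnDeriv_smul (f := f) hPQ hF
  rw [h1, ← h3]
  exact h2.symm

variable {S : Type*} [MeasurableSpace S] [MeasurableSingletonClass S] [Countable S] {T : ℝ}

/-- A density `D` of `P` with respect to `Q` on `m` lets both conditional laws, integrated over a
set of `m`, be written as signed measures on path space. These agree on cylinders, hence everywhere.
-/
theorem sameCondLaw_of_pointCylinders (hm : m ≤ mΩ) (hPQ : P.trim hm ≪ Q.trim hm)
    {X Y : ℝ → Ω → S} (hX : ∀ t ∈ Icc 0 T, Measurable (X t))
    (hY : ∀ t ∈ Icc 0 T, Measurable (Y t))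
    (h : ∀ (J : Finset (Icc (0 : ℝ) T)) (f : Icc (0 : ℝ) T → S),
      P⟦{ω | ∀ t ∈ J, X t ω = f t}|m⟧ =ᵐ[P] Q⟦{ω | ∀ t ∈ J, Y t ω = f t}|m⟧) :
    SameCondLaw T P Q m X Y := by
  intro B hB
  obtain ⟨D, hDm, hDi, hD⟩ := exists_density_of_trim_absolutelyContinuous hm hPQ
  set C : Set (Set (Icc (0 : ℝ) T → S)) := pointCylinders (fun t w => w t) univ with hC
  set W : Ω → Icc (0 : ℝ) T → S := fun ω t => X t ω with hW
  set V : Ω → Icc (0 : ℝ) T → S := fun ω t => Y t ω with hV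
  have hWm : Measurable W := measurable_pi_lambda _ fun t => hX t t.2
  have hVm : Measurable V := measurable_pi_lambda _ fun t => hY t t.2
  have hCle : MeasurableSpace.generateFrom C ≤ MeasurableSpace.pi :=
    generateFrom_pointCylinders_le fun t _ => measurable_pi_apply t
  have hpi : MeasurableSpace.pi ≤ MeasurableSpace.generateFrom C := iSup_le fun t =>
    (measurable_generateFrom_pointCylinders
      (Z := fun (t : Icc (0 : ℝ) T) (w : Icc (0 : ℝ) T → S) => w t) (mem_univ t)).comap_le
  have hint : ∀ A, MeasurableSet A → Integrable (Q⟦V ⁻¹' A|m⟧) P := by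
    intro A hA
    refine Integrable.of_bound
      (stronglyMeasurable_condExp.mono hm).aestronglyMeasurable 1 ?_
    have h1 : ∀ᵐ ω ∂Q, ‖(Q⟦V ⁻¹' A|m⟧) ω‖ ≤ 1 := by
      filter_upwards [ae_condExp_indicator_mem_Icc (m := m) _ (hVm hA)] with ω hω
      rw [Real.norm_eq_abs, abs_of_nonneg hω.1]
      exact hω.2
    have hset : MeasurableSet[m] {ω | ‖(Q⟦V ⁻¹' A|m⟧) ω‖ ≤ 1} :=
      StronglyMeasurable.measurableSet_le (stronglyMeasurable_condExp.norm)
        (@stronglyMeasurable_const _ _ m _ _)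
    refine ae_of_ae_trim hm (hPQ.ae_le ?_)
    exact mem_ae_iff.2 ((trim_measurableSet_eq hm hset.compl).trans (mem_ae_iff.1 h1))
  have key : ∀ (F : Set Ω) (A : Set (Icc (0 : ℝ) T → S)), MeasurableSet[m] F → MeasurableSet A →
      (∫ ω in F, (Q⟦V ⁻¹' A|m⟧) ω ∂P = ∫ ω in F, (P⟦W ⁻¹' A|m⟧) ω ∂P ↔
      ∫ ω in W ⁻¹' A, F.indicator (fun _ => (1 : ℝ)) ω ∂P
        = ∫ ω in V ⁻¹' A, F.indicator D ω ∂Q) := by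
    intro F A hF hA
    rw [hD _ stronglyMeasurable_condExp F hF, setIntegral_condExp_indicator hm (hWm hA) hF,
      ← integral_condExp_indicator_mul hm (hVm hA) hDm.aestronglyMeasurable hDi hF]
    simp only [mul_comm]
    exact eq_comm
  refine (ae_eq_condExp_of_forall_setIntegral_eq hm (integrable_indicator_one (hWm hB))
    (fun _ _ _ => (hint B hB).integrableOn) (fun F hF _ => ?_)
    stronglyMeasurable_condExp.aestronglyMeasurable).symm
  rw [← setIntegral_condExp hm (integrable_indicator_one (hWm hB)) hF]
  refine (key F B hF hB).2 ?_
  refine setIntegral_preimage_eq_of_isPiSystem isPiSystem_pointCylinders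
    (fun A hA => hWm (hCle A hA)) (fun A hA => hVm (hCle A hA))
    (integrable_indicator_one (hm _ hF)) (hDi.indicator (hm _ hF)) ?_ ?_ (hpi B hB)
  · have h1 := hD (fun _ => 1) (@stronglyMeasurable_const _ _ m _ _) F hF
    simp only [mul_one] at h1
    rw [integral_indicator (hm _ hF), integral_indicator (hm _ hF), h1]
  · intro A hA
    have hAm := hCle _ (MeasurableSpace.measurableSet_generateFrom hA)
    refine (key F A hF hAm).1 (setIntegral_congr_ae (hm _ hF) ?_)
    obtain ⟨J, -, f, rfl⟩ := hA
    exact (h J f).mono fun _ h _ => h.symm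

end PathLaw

/-! ### Cylinders as products -/

section Cylinder

/-- The factors of the indicator of the cylinder `{Z t = f t, t ∈ J}` at the times of `J'`. -/
def cylinderFactor {ι S : Type*} [LinearOrder ι] [DecidableEq S] (J J' : Finset ι) (f : ι → S)
    (i : Fin J'.card) (c : S) : ℝ :=
  if J'.orderEmbOfFin rfl i ∈ J → c = f (J'.orderEmbOfFin rfl i) then 1 else 0

variable {ι S : Type*} [LinearOrder ι] [DecidableEq S] {J J' : Finset ι} {f : ι → S}

theorem abs_cylinderFactor_le (i : Fin J'.card) (c : S) : |cylinderFactor J J' f i c| ≤ 1 := by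
  unfold cylinderFactor
  split_ifs <;> simp

/-- Times of `J'` outside `J` contribute the factor one, so cylinders based on different times can
share a grid. -/
theorem indicator_pointCylinder {Ω : Type*} (Z : ι → Ω → S) (hJ : J ⊆ J') :
    ({ω | ∀ t ∈ J, Z t ω = f t}.indicator fun _ => (1 : ℝ))
      = fun ω => ∏ i, cylinderFactor J J' f i (Z (J'.orderEmbOfFin rfl i) ω) := by
  classical
  ext ω
  simp only [cylinderFactor, Finset.prod_ite_zero, Finset.prod_const_one, Finset.mem_univ,
    true_imp_iff, indicator_apply, mem_ofPred_eq]
  refine if_congr ⟨fun h i hi => h _ hi, fun h t ht => ?_⟩ rfl rfl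
  have ht' : t ∈ Set.range (J'.orderEmbOfFin rfl) := by
    rw [Finset.range_orderEmbOfFin]; exact hJ ht
  obtain ⟨i, rfl⟩ := ht'
  exact h i ht

end Cylinder

/-! ### Path weights -/

section PathWeight

variable {Ω : Type*}

/-- Distributivity at each time step: a sum over the product set of products over coordinates is a
product of sums. -/
theorem pathWeight_kroneckerProd {N : ℕ} {S : Fin N → Type*} [∀ k, Fintype (S k)]
    {p : ℝ → ℝ → Ω → Matrix (∀ k, S k) (∀ k, S k) ℝ}
    {q : ∀ k, ℝ → ℝ → Ω → Matrix (S k) (S k) ℝ} {T : ℝ} {ω : Ω}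
    (h : ∀ s t, 0 ≤ s → s ≤ t → t ≤ T → ∀ x y, p s t ω x y = ∏ k, q k s t ω (x k) (y k))
    {n : ℕ} {s : ℝ} (hs : 0 ≤ s) {τ : Fin n → ℝ} (hτ : Monotone τ)
    (hsτ : ∀ i, s ≤ τ i ∧ τ i ≤ T) (g : ∀ k, Fin n → S k → ℝ) (x : ∀ k, S k) :
    pathWeight p n s τ (fun i y => ∏ k, g k i (y k)) x ω
      = ∏ k, pathWeight (q k) n s τ (g k) (x k) ω := by
  induction n generalizing s x with
  | zero => simp [pathWeight]
  | succ n ih =>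
    obtain ⟨h1, h2⟩ := tail_times hτ fun i => (hsτ i).2
    have hih := ih (hs.trans (hsτ 0).1) h1 h2 (fun k => Fin.tail (g k))
    simp only [pathWeight]
    rw [Finset.prod_univ_sum, Fintype.piFinset_univ]
    refine Finset.sum_congr rfl fun y _ => ?_
    rw [h s (τ 0) hs (hsτ 0).1 (hsτ 0).2, Finset.prod_mul_distrib, Finset.prod_mul_distrib,
      ← hih y]
    rfl

theorem pathWeight_congr {S : Type*} [Fintype S] {p q : ℝ → ℝ → Ω → Matrix S S ℝ} {T : ℝ}
    [MeasurableSpace Ω] {P : Measure Ω}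
    (h : ∀ s t, 0 ≤ s → s ≤ t → t ≤ T → ∀ x y,
      (fun ω => p s t ω x y) =ᵐ[P] fun ω => q s t ω x y)
    {n : ℕ} {s : ℝ} (hs : 0 ≤ s) {τ : Fin n → ℝ} (hτ : Monotone τ)
    (hsτ : ∀ i, s ≤ τ i ∧ τ i ≤ T) (g : Fin n → S → ℝ) (x : S) :
    pathWeight p n s τ g x =ᵐ[P] pathWeight q n s τ g x := by
  induction n generalizing s x with
  | zero => rfl
  | succ n ih =>
    obtain ⟨h1, h2⟩ := tail_times hτ fun i => (hsτ i).2
    have hih : ∀ᵐ ω ∂P, ∀ y, _ := ae_all_iff.2 (ih (hs.trans (hsτ 0).1) h1 h2 (Fin.tail g))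
    have hp : ∀ᵐ ω ∂P, ∀ y, _ := ae_all_iff.2 (h s (τ 0) hs (hsτ 0).1 (hsτ 0).2 x)
    filter_upwards [hih, hp] with ω h3 h4
    exact Finset.sum_congr rfl fun y _ => by rw [h3 y, h4 y]

end PathWeight

/-! ### Chains whose intensity is a Kronecker sum -/

section Copula

variable {Ω : Type*} {m : MeasurableSpace Ω} [mΩ : MeasurableSpace Ω] {𝓕 : Filtration ℝ mΩ}
  {𝓗 : ℝ → MeasurableSpace Ω} {T : ℝ} {P : Measure Ω} {N : ℕ} {S : Fin N → Type*}

theorem IsAdaptedCadlag.component [∀ k, MeasurableSpace (S k)] {X : ℝ → Ω → ∀ k, S k}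
    (hX : IsAdaptedCadlag T 𝓗 X) (k : Fin N) : IsAdaptedCadlag T 𝓗 (component X k) where
  le := hX.le
  adapted t ht := (measurable_pi_apply k).comp (hX.adapted t ht)
  cadlag ω := ⟨fun t ht => ((hX.cadlag ω).1 t ht).mono fun _ hu => congr_fun hu k, fun t ht => by
    obtain ⟨x, hx⟩ := (hX.cadlag ω).2 t ht
    exact ⟨x k, hx.mono fun _ hu => congr_fun hu k⟩⟩

variable [∀ k, Fintype (S k)]

theorem ae_kroneckerSum_data {Ψ : ∀ k, ℝ → Ω → Matrix (S k) (S k) ℝ}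
    (hT : 0 ≤ T) (hΨ : ∀ k, IsIntensityProcess 𝓕 T P (Ψ k)) :
    ∀ᵐ ω ∂P, (∀ u ∈ Icc 0 T, ∀ k x, ∑ y, Ψ k u ω x y = 0) ∧
      ∀ k x y, IntervalIntegrable (fun u => Ψ k u ω x y) volume 0 T := by
  have h1 : ∀ᵐ ω ∂P, ∀ k, ∀ u ∈ Icc 0 T, ∀ x, ∑ y, Ψ k u ω x y = 0 :=
    ae_all_iff.2 fun k => (hΨ k).row_sum
  have h2 : ∀ᵐ ω ∂P, ∀ k, ∀ x y, IntervalIntegrable (fun u => Ψ k u ω x y) volume 0 T :=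
    ae_all_iff.2 fun k => (hΨ k).ae_intervalIntegrable hT
  filter_upwards [h1, h2] with ω h1 h2 using ⟨fun u hu k => h1 k u hu, h2⟩

variable [∀ k, DecidableEq (S k)]

/-- The marginals of a family of transition matrices on a product set. -/
def marginalField (x₀ : ∀ k, S k) (p : ℝ → ℝ → Ω → Matrix (∀ k, S k) (∀ k, S k) ℝ) (k : Fin N) :
    ℝ → ℝ → Ω → Matrix (S k) (S k) ℝ :=
  fun s t ω => marginalMatrix x₀ k (p s t ω)

variable {Ψ : ∀ k, ℝ → Ω → Matrix (S k) (S k) ℝ}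
  {p : ℝ → ℝ → Ω → Matrix (∀ k, S k) (∀ k, S k) ℝ}

theorem ae_eq_prod_marginalField (hT : 0 ≤ T)
    (hΨ : ∀ k, IsIntensityProcess 𝓕 T P (Ψ k))
    (hk : ∀ᵐ ω ∂P, SolvesKolmogorov T (fun u => kroneckerSum fun k => Ψ k u ω) fun s t => p s t ω)
    (x₀ : ∀ k, S k) :
    ∀ᵐ ω ∂P, ∀ s t, 0 ≤ s → s ≤ t → t ≤ T → ∀ x y,
      p s t ω x y = ∏ k, marginalField x₀ p k s t ω (x k) (y k) := by
  filter_upwards [ae_kroneckerSum_data hT hΨ, hk] with ω h h' s t hs hst ht x y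
  exact h'.eq_prod_marginalMatrix h.1 h.2 x₀ hs hst ht x y

theorem ae_sum_filter_eq_marginalField (hT : 0 ≤ T)
    (hΨ : ∀ k, IsIntensityProcess 𝓕 T P (Ψ k))
    (hk : ∀ᵐ ω ∂P, SolvesKolmogorov T (fun u => kroneckerSum fun k => Ψ k u ω) fun s t => p s t ω)
    (x₀ : ∀ k, S k) (k : Fin N) :
    ∀ᵐ ω ∂P, ∀ s t, 0 ≤ s → s ≤ t → t ≤ T → ∀ x b,
      ∑ y : ∀ j, S j with y k = b, p s t ω x y = marginalField x₀ p k s t ω (x k) b := by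
  filter_upwards [ae_kroneckerSum_data hT hΨ, hk] with ω h h' s t hs hst ht x b
  exact h'.sum_filter_eq_marginalMatrix h.1 h.2 x₀ hs hst ht k x b

theorem ae_solvesKolmogorov_marginalField (hT : 0 ≤ T)
    (hΨ : ∀ k, IsIntensityProcess 𝓕 T P (Ψ k))
    (hk : ∀ᵐ ω ∂P, SolvesKolmogorov T (fun u => kroneckerSum fun k => Ψ k u ω) fun s t => p s t ω)
    (x₀ : ∀ k, S k) (k : Fin N) :
    ∀ᵐ ω ∂P, SolvesKolmogorov T (fun u => Ψ k u ω) fun s t => marginalField x₀ p k s t ω := by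
  filter_upwards [ae_kroneckerSum_data hT hΨ, hk] with ω h h'
  exact h'.marginalMatrix h.1 h.2 x₀ k

variable [∀ k, MeasurableSpace (S k)] [∀ k, DiscreteMeasurableSpace (S k)]
  {X : ℝ → Ω → ∀ k, S k} [IsFiniteMeasure P]

theorem condExp_indicator_component_eq (hX : IsAdaptedCadlag T 𝓗 X) {t : ℝ} (ht : t ∈ Icc 0 T)
    (k : Fin N) (b : S k) :
    P⟦{ω | component X k t ω = b}|m⟧ =ᵐ[P]
      fun ω => ∑ y : ∀ j, S j with y k = b, (P⟦{ω | X t ω = y}|m⟧) ω := by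
  have h1 : ({ω | component X k t ω = b}.indicator fun _ => (1 : ℝ))
      = ∑ y : ∀ j, S j with y k = b, {ω | X t ω = y}.indicator fun _ => (1 : ℝ) := by
    ext ω
    rw [Finset.sum_apply]
    simp only [indicator_apply, mem_ofPred_eq, Finset.sum_ite_eq, Finset.mem_filter,
      Finset.mem_univ, true_and]
    rfl
  rw [h1]
  refine (condExp_finsetSum (fun y _ => integrable_indicator_one
    (hX.measurable ht (measurableSet_singleton y))) m).trans
    (ae_of_all _ fun ω => Finset.sum_apply ω _ _)

/-- By lumpability, the sum of the joint transition probabilities over a fibre sees only the k-th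
coordinate of the current state, even when conditioning on the whole of `𝓗 s`. -/
theorem IsCTransitionField.component (hp : IsCTransitionField 𝓕 𝓗 T P X p)
    (hX : IsAdaptedCadlag T 𝓗 X) (x₀ : ∀ k, S k) (k : Fin N)
    (hsum : ∀ᵐ ω ∂P, ∀ s t, 0 ≤ s → s ≤ t → t ≤ T → ∀ x b,
      ∑ y : ∀ j, S j with y k = b, p s t ω x y = marginalField x₀ p k s t ω (x k) b) :
    IsCTransitionField 𝓕 𝓗 T P (component X k) (marginalField x₀ p k) where
  measurable s t hs hst ht _ _ :=
    Finset.measurable_sum _ fun y _ => hp.measurable s t hs hst ht _ y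
  stochastic s t hs hst ht := by
    filter_upwards [hp.stochastic s t hs hst ht] with ω h
    exact ⟨marginalMatrix_nonneg h.1 x₀ k, sum_marginalMatrix h.2 x₀ k⟩
  transition s t hs hst ht b := by
    have hall : ∀ᵐ ω ∂P, ∀ y, (P⟦{ω | X t ω = y}|𝓕 T ⊔ 𝓗 s⟧) ω = p s t ω (X s ω) y :=
      ae_all_iff.2 fun y => hp.transition s t hs hst ht y
    refine (condExp_indicator_component_eq hX ⟨hs.trans hst, ht⟩ k b).trans ?_
    filter_upwards [hall, hsum] with ω h1 h2
    simp only [h1]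
    exact h2 s t hs hst ht (X s ω) b

/-- Conditional independence of the components of a chain whose transition matrices are Kronecker
products. -/
theorem condIndepGiven_history (hT : 0 ≤ T) (hX : IsAdaptedCadlag T 𝓗 X)
    (h𝓗 : MonotoneOn 𝓗 (Icc 0 T)) (hp : IsCTransitionField 𝓕 𝓗 T P X p)
    {q : ∀ k, ℝ → ℝ → Ω → Matrix (S k) (S k) ℝ}
    (hq : ∀ k, IsCTransitionField 𝓕 𝓗 T P (component X k) (q k))
    (hpq : ∀ᵐ ω ∂P, ∀ s t, 0 ≤ s → s ≤ t → t ≤ T → ∀ x y,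
      p s t ω x y = ∏ k, q k s t ω (x k) (y k))
    (hX0 : ∀ x : ∀ k, S k,
      P⟦{ω | X 0 ω = x}|𝓕 T⟧ =ᵐ[P] ∏ k, P⟦{ω | X 0 ω k = x k}|𝓕 T⟧) (x₀ : ∀ k, S k) :
    CondIndepGiven P (𝓕 T) fun k => history (component X k) T := by
  classical
  intro s A hA
  set A' : Fin N → Set Ω := fun k => if k ∈ s then A k else univ with hA'
  have h1 : ⋂ k ∈ s, A k = ⋂ k, A' k := by
    ext ω
    simp only [mem_iInter, hA']
    refine forall_congr' fun k => ?_
    by_cases hk : k ∈ s <;> simp [hk]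
  have h2 : ∏ k ∈ s, P⟦A k|𝓕 T⟧ = ∏ k, P⟦A' k|𝓕 T⟧ := by
    rw [← Finset.prod_subset (Finset.subset_univ s)]
    · exact Finset.prod_congr rfl fun k hk => by simp only [hA', if_pos hk]
    · intro k _ hk
      simp only [hA', if_neg hk, indicator_univ, condExp_const (𝓕.le T)]
      rfl
  rw [h1, h2]
  have hcm : ∀ k, ∀ t ∈ Icc 0 T, Measurable (component X k t) := fun k t ht =>
    (hX.component k).measurable ht
  refine condExp_iInter_eq_prod_of_isPiSystem (𝓕.le T)
    (C := fun k => pointCylinders (component X k) (Icc 0 T))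
    (fun k => isPiSystem_pointCylinders) (fun k => generateFrom_pointCylinders_le (hcm k))
    ?_ (fun k => ⟨∅, by simp, fun _ => x₀ k, by simp⟩) (fun k => history_le_generateFrom _ _ _ ?_)
  · intro A hA
    choose J hJ f hf using hA
    -- The cylinders of the components use different times; their union is a common grid on which
    -- the joint path weight can be factorised.
    set J' : Finset ℝ := Finset.univ.biUnion J with hJ'
    have hJJ' : ∀ k, J k ⊆ J' := fun k => Finset.subset_biUnion_of_mem J (Finset.mem_univ k)
    set τ : Fin J'.card → ℝ := fun i => J'.orderEmbOfFin rfl i with hτdef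
    have hτ : Monotone τ := fun i j hij => (J'.orderEmbOfFin rfl).monotone hij
    have hτT : ∀ i, 0 ≤ τ i ∧ τ i ≤ T := by
      intro i
      obtain ⟨k, -, hk⟩ := Finset.mem_biUnion.1 (J'.orderEmbOfFin_mem rfl i)
      exact hJ k hk
    set g : ∀ k, Fin J'.card → S k → ℝ := fun k => cylinderFactor (J k) J' (f k) with hg
    have hg1 : ∀ k i y, |g k i y| ≤ 1 := fun k => abs_cylinderFactor_le
    have hind : ∀ k, ((A k).indicator fun _ => (1 : ℝ))
        = fun ω => ∏ i, g k i (component X k (τ i) ω) := fun k => by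
      rw [hf k]; exact indicator_pointCylinder (component X k) (hJJ' k)
    have hinter : ((⋂ k, A k).indicator fun _ => (1 : ℝ))
        = fun ω => ∏ i, ∏ k, g k i (X (τ i) ω k) := by
      ext ω
      rw [Finset.prod_comm]
      have h3 : ((⋂ k, A k).indicator (fun _ => (1 : ℝ)) ω)
          = ∏ k, (A k).indicator (fun _ => (1 : ℝ)) ω := by
        simp only [indicator_apply, Finset.prod_ite_zero, Finset.prod_const_one, mem_iInter,
          Finset.mem_univ, true_imp_iff]
      rw [h3]
      exact Finset.prod_congr rfl fun k _ => congr_fun (hind k) ω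
    have hjoint := hp.condExp_prod_terminal hX h𝓗 hT hτ hτT
      (g := fun i y => ∏ k, g k i (y k)) fun i y => by
        rw [Finset.abs_prod]
        exact Finset.prod_le_one (fun _ _ => abs_nonneg _) fun k _ => hg1 k i _
    have hmarg : ∀ᵐ ω ∂P, ∀ k, (P⟦A k|𝓕 T⟧) ω = ∑ z, pathWeight (q k) _ 0 τ (g k) z ω *
        (P⟦{ω | component X k 0 ω = z}|𝓕 T⟧) ω := by
      refine ae_all_iff.2 fun k => ?_
      rw [hind k]
      exact (hq k).condExp_prod_terminal (hX.component k) h𝓗 hT hτ hτT (hg1 k)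
    have hinit : ∀ᵐ ω ∂P, ∀ x : ∀ k, S k, (P⟦{ω | X 0 ω = x}|𝓕 T⟧) ω
        = (∏ k, P⟦{ω | X 0 ω k = x k}|𝓕 T⟧) ω := ae_all_iff.2 hX0
    rw [hinter]
    refine hjoint.trans ?_
    filter_upwards [hmarg, hinit, hpq] with ω h3 h4 h5
    rw [Finset.prod_apply]
    simp only [h3, h4, Finset.prod_apply]
    rw [Finset.prod_univ_sum, Fintype.piFinset_univ]
    refine Finset.sum_congr rfl fun x _ => ?_
    rw [pathWeight_kroneckerProd h5 le_rfl hτ hτT, ← Finset.prod_mul_distrib]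
    rfl
  · by_cases hk : k ∈ s
    · simpa only [hA', if_pos hk] using hA k hk
    · simp only [hA', if_neg hk]
      exact @MeasurableSet.univ _ (history (CondMarkov.component X k) T)

end Copula

/-! ### Dependence of the conditional laws on the initial law and the transition matrices -/

section Laws

variable {Ω S : Type*} [mΩ : MeasurableSpace Ω] {𝓕 : Filtration ℝ mΩ}
  {𝓗 𝓗' : ℝ → MeasurableSpace Ω} {T : ℝ} {P Q : Measure Ω} [IsFiniteMeasure P]
  [Fintype S] [DecidableEq S] [MeasurableSpace S] [MeasurableSingletonClass S]
  {X Y : ℝ → Ω → S} {p q : ℝ → ℝ → Ω → Matrix S S ℝ}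

/-- In the finite-dimensional formula the path weights involve only times up to `u` and the initial
law is `𝓕 0`-measurable modulo null sets, so the whole expression is `𝓕 u`-measurable modulo null
sets. -/
theorem condExp_pointCylinder_eq_of_initial (hT : 0 ≤ T) (hX : IsAdaptedCadlag T 𝓗 X)
    (h𝓗 : MonotoneOn 𝓗 (Icc 0 T)) (hp : IsCTransitionField 𝓕 𝓗 T P X p)
    (h0 : ∀ x, AEStronglyMeasurable[𝓕 0] (P⟦{ω | X 0 ω = x}|𝓕 T⟧) P) {u : ℝ} (hu : u ∈ Icc 0 T)
    {B : Set Ω} (hB : B ∈ pointCylinders X (Icc 0 u)) : P⟦B|𝓕 T⟧ =ᵐ[P] P⟦B|𝓕 u⟧ := by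
  obtain ⟨J, hJ, f, rfl⟩ := hB
  have hJu : ∀ i, 0 ≤ J.orderEmbOfFin rfl i ∧ J.orderEmbOfFin rfl i ≤ u := fun i =>
    hJ (J.orderEmbOfFin_mem rfl i)
  have hτ : Monotone (J.orderEmbOfFin rfl) := (J.orderEmbOfFin rfl).monotone
  have h1 := hp.condExp_prod_terminal hX h𝓗 hT hτ (fun i => ⟨(hJu i).1, (hJu i).2.trans hu.2⟩)
    (g := cylinderFactor J J f) abs_cylinderFactor_le
  rw [← indicator_pointCylinder X subset_rfl] at h1
  refine (condExp_ae_eq_of_le (𝓕.le T) (𝓕.mono hu.2) (integrable_indicator_one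
    (measurableSet_of_mem_pointCylinders (I := Icc 0 T) (fun t ht => hX.measurable ht)
      ⟨J, fun t ht => ⟨(hJ ht).1, (hJ ht).2.trans hu.2⟩, f, rfl⟩)) (ae_eq_refl _) ?_).symm
  refine AEStronglyMeasurable.congr ?_ h1.symm
  choose G hG hGe using h0
  refine ⟨fun ω => ∑ z, pathWeight p _ 0 _ (cylinderFactor J J f) z ω * G z ω,
    Finset.stronglyMeasurable_fun_sum _ fun z _ =>
      (hp.measurable_pathWeight le_rfl hτ hJu hu.2 _ z).stronglyMeasurable.mul
        ((hG z).mono (𝓕.mono hu.1)), ?_⟩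
  filter_upwards [ae_all_iff.2 hGe] with ω hω
  exact Finset.sum_congr rfl fun z _ => by rw [hω z]

/-- The formula for `Y` holds `Q`-a.s. with both sides `𝓕 T`-measurable, hence also `P`-a.s., where
it can be matched term by term with the formula for `X`. -/
theorem sameCondLaw_of_transitionField [IsFiniteMeasure Q] (hT : 0 ≤ T)
    (hPQ : P.trim (𝓕.le T) ≪ Q.trim (𝓕.le T))
    (hX : IsAdaptedCadlag T 𝓗 X) (h𝓗 : MonotoneOn 𝓗 (Icc 0 T))
    (hp : IsCTransitionField 𝓕 𝓗 T P X p)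
    (hY : IsAdaptedCadlag T 𝓗' Y) (h𝓗' : MonotoneOn 𝓗' (Icc 0 T))
    (hq : IsCTransitionField 𝓕 𝓗' T Q Y q)
    (hpq : ∀ s t, 0 ≤ s → s ≤ t → t ≤ T → ∀ x y,
      (fun ω => p s t ω x y) =ᵐ[P] fun ω => q s t ω x y)
    (h0 : ∀ x, P⟦{ω | X 0 ω = x}|𝓕 T⟧ =ᵐ[P] Q⟦{ω | Y 0 ω = x}|𝓕 T⟧) :
    SameCondLaw T P Q (𝓕 T) X Y := by
  refine sameCondLaw_of_pointCylinders (𝓕.le T) hPQ (fun t ht => hX.measurable ht)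
    (fun t ht => hY.measurable ht) fun J f => ?_
  set τ : Fin J.card → ℝ := fun i => (J.orderEmbOfFin rfl i : Icc (0 : ℝ) T) with hτdef
  have hτ : Monotone τ := fun i j hij => (J.orderEmbOfFin rfl).monotone hij
  have hτT : ∀ i, 0 ≤ τ i ∧ τ i ≤ T := fun i => (J.orderEmbOfFin rfl i).2
  have hXc := hp.condExp_prod_terminal hX h𝓗 hT hτ hτT
    (g := cylinderFactor J J f) abs_cylinderFactor_le
  have hYc := hq.condExp_prod_terminal hY h𝓗' hT hτ hτT
    (g := cylinderFactor J J f) abs_cylinderFactor_le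
  rw [indicator_pointCylinder (fun (t : Icc (0 : ℝ) T) => X t) subset_rfl,
    indicator_pointCylinder (fun (t : Icc (0 : ℝ) T) => Y t) subset_rfl]
  have hYP := ae_eq_of_trim_absolutelyContinuous (𝓕.le T) hPQ stronglyMeasurable_condExp
    (Finset.stronglyMeasurable_fun_sum _ fun z _ =>
      (hq.measurable_pathWeight le_rfl hτ hτT le_rfl _ z).stronglyMeasurable.mul
        stronglyMeasurable_condExp) hYc
  refine hXc.trans (EventuallyEq.trans ?_ hYP.symm)
  have hW : ∀ᵐ ω ∂P, ∀ z, _ := ae_all_iff.2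
    (pathWeight_congr hpq le_rfl hτ hτT (cylinderFactor J J f))
  have h0' : ∀ᵐ ω ∂P, ∀ z, _ := ae_all_iff.2 h0
  filter_upwards [hW, h0'] with ω h1 h2
  exact Finset.sum_congr rfl fun z _ => by rw [h1 z, h2 z]; rfl

end Laws

end CondMarkov

end

/-! ### Conditional independence and the strong copula property -/

theorem mainTheorem12 {Ω : Type*} [mΩ : MeasurableSpace Ω] {T : ℝ} (hT : 0 < T)
    (𝓕 𝓖 : Filtration ℝ mΩ)
    (h𝓕 : CondMarkov.IsRightContinuousOn T 𝓕) (h𝓖 : CondMarkov.IsRightContinuousOn T 𝓖)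
    (P : Measure Ω) [IsProbabilityMeasure P]
    {N : ℕ} {S : Fin N → Type*} [∀ k, Fintype (S k)] [∀ k, DecidableEq (S k)]
    [∀ k, MeasurableSpace (S k)] [∀ k, DiscreteMeasurableSpace (S k)]
    -- the marginal intensities
    (Ψ : ∀ k, ℝ → Ω → Matrix (S k) (S k) ℝ)
    (hΨ : ∀ k, CondMarkov.IsIntensityProcess 𝓕 T P (Ψ k))
    -- the chain, whose intensity is the Kronecker sum
    (X : ℝ → Ω → ∀ k, S k)
    (hX : CondMarkov.IsDSMCWithIntensity 𝓕 𝓖 T P X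
      (fun t ω => CondMarkov.kroneckerSum fun k => Ψ k t ω))
    -- the initial law is conditionally independent
    (hX0 : ∀ x : ∀ k, S k,
      P⟦{ω | X 0 ω = x} | 𝓕 T⟧ =ᵐ[P] ∏ k, P⟦{ω | X 0 ω k = x k} | 𝓕 T⟧) :
    CondMarkov.CondIndepGiven P (𝓕 T)
      (fun k => CondMarkov.history (CondMarkov.component X k) T) ∧
    ∀ (Q : Measure Ω) [IsProbabilityMeasure Q] (Y : ∀ k, ℝ → Ω → S k),
      P.trim (𝓕.le T) ≪ Q.trim (𝓕.le T) →
      (∀ k, CondMarkov.IsCDMC 𝓕 (CondMarkov.generatedFiltration T Q (Y k)) T Q (Y k) (Ψ k)) →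
      (∀ k (x : S k), Q⟦{ω | Y k 0 ω = x} | 𝓕 T⟧ =ᵐ[Q] Q⟦{ω | Y k 0 ω = x} | 𝓕 0⟧) →
      (∀ k (x : S k), P⟦{ω | X 0 ω k = x} | 𝓕 T⟧ =ᵐ[P] Q⟦{ω | Y k 0 ω = x} | 𝓕 T⟧) →
      CondMarkov.IsStrongCMCCopula 𝓕 T P Q X Y ∧
      CondMarkov.IsCDMC 𝓕 (CondMarkov.generatedFiltration T P X) T P X
        (fun t ω => CondMarkov.kroneckerSum fun k => Ψ k t ω) ∧
      ∀ k, CondMarkov.IsCDMC 𝓕 (CondMarkov.generatedFiltration T P X) T P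
        (CondMarkov.component X k) (Ψ k) := by
  have hX' := hX.dsmc.process
  obtain ⟨p, hp, hk⟩ := hX.kolmogorov
  obtain ⟨ω₀⟩ : Nonempty Ω := P.nonempty_of_neZero
  set x₀ : ∀ k, S k := X 0 ω₀
  set q := CondMarkov.marginalField x₀ p with hq
  have hprod := CondMarkov.ae_eq_prod_marginalField hT.le hΨ hk x₀
  have hsum := fun k => CondMarkov.ae_sum_filter_eq_marginalField hT.le hΨ hk x₀ k
  have hkol := fun k => CondMarkov.ae_solvesKolmogorov_marginalField hT.le hΨ hk x₀ k
  have hcomp := fun k => hp.component hX' x₀ k (hsum k)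
  have h𝓖mono : MonotoneOn 𝓖 (Icc 0 T) := fun _ _ _ _ hst => 𝓖.mono hst
  have h0 : (0 : ℝ) ∈ Icc 0 T := ⟨le_rfl, hT.le⟩
  refine ⟨CondMarkov.condIndepGiven_history hT.le hX' h𝓖mono hp hcomp hprod hX0 x₀,
    fun Q _ Y hPQ hY hY0 hXY0 => ?_⟩
  have hXm : ∀ t ∈ Icc 0 T, Measurable (X t) := fun t ht => hX'.measurable ht
  set 𝓗 := CondMarkov.generatedFiltration T P X with h𝓗
  have h𝓗mono : MonotoneOn 𝓗 (Icc 0 T) := CondMarkov.generatedFiltration_mono.monotoneOn _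
  have hXad : CondMarkov.IsAdaptedCadlag T 𝓗 X :=
    CondMarkov.isAdaptedCadlag_generatedFiltration hXm hX'.cadlag
  have hle : ∀ t ∈ Icc 0 T, 𝓗 t ≤ eventuallyMeasurableSpace (𝓖 t) (ae P) := fun t ht =>
    CondMarkov.generatedFiltration_le_eventuallyMeasurableSpace
      (CondMarkov.iInf_history_le h𝓖 hX'.adapted ht)
  have hpX : CondMarkov.IsCTransitionField 𝓕 𝓗 T P X p := hp.of_le hX'.le hXad hle
  have hpk : ∀ k, CondMarkov.IsCTransitionField 𝓕 𝓗 T P (CondMarkov.component X k) (q k) :=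
    fun k => hpX.component hXad x₀ k (hsum k)
  -- The initial law factorises into those of the target processes under `Q`, which are `𝓕
  -- 0`-measurable by assumption. The identity under `Q` passes to `P` because both sides are `𝓕
  -- T`-measurable.
  have hinit : ∀ x, AEStronglyMeasurable[𝓕 0] (P⟦{ω | X 0 ω = x}|𝓕 T⟧) P := by
    intro x
    refine AEStronglyMeasurable.congr (f := ∏ k, Q⟦{ω | Y k 0 ω = x k}|𝓕 0⟧)
      (Finset.stronglyMeasurable_prod _ fun k _ =>
        stronglyMeasurable_condExp).aestronglyMeasurable ?_
    have h1 : ∀ᵐ ω ∂P, ∀ k, (P⟦{ω | X 0 ω k = x k}|𝓕 T⟧) ω = (Q⟦{ω | Y k 0 ω = x k}|𝓕 0⟧) ω :=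
      ae_all_iff.2 fun k => (hXY0 k (x k)).trans
        (CondMarkov.ae_eq_of_trim_absolutelyContinuous (𝓕.le T) hPQ stronglyMeasurable_condExp
          (stronglyMeasurable_condExp.mono (𝓕.mono hT.le)) (hY0 k (x k)))
    filter_upwards [hX0 x, h1] with ω h2 h3
    rw [h2, Finset.prod_apply, Finset.prod_apply]
    exact Finset.prod_congr rfl fun k _ => (h3 k).symm
  have himm : ∀ t ∈ Icc 0 T, ∀ B, MeasurableSet[𝓗 t] B → P⟦B|𝓕 T⟧ =ᵐ[P] P⟦B|𝓕 t⟧ :=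
    fun t ht B hB => CondMarkov.condExp_indicator_generatedFiltration h𝓕 hXm
      (fun u hu B hB => CondMarkov.condExp_pointCylinder_eq_of_initial hT.le hXad h𝓗mono hpX hinit
        hu hB) ht hB
  have hXcmc := hpX.isCMC hXad h𝓗mono himm
  -- The immersion property concerns the filtration of the full chain, so it serves each component
  -- unchanged; this is strong Markovian consistency.
  have hkcmc := fun k => (hpk k).isCMC (hXad.component k) h𝓗mono himm
  refine ⟨⟨fun k => (hY k).1, hXcmc, hkcmc, fun k => ?_⟩,
    ⟨hXcmc, hpX.isDSMC hXad, hX.intensity, p, hpX, hk⟩,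
    fun k => ⟨hkcmc k, (hpk k).isDSMC (hXad.component k), hΨ k, q k, hpk k, hkol k⟩⟩
  obtain ⟨r, hr, hrk⟩ := (hY k).2.kolmogorov
  exact CondMarkov.sameCondLaw_of_transitionField hT.le hPQ (hXad.component k) h𝓗mono (hpk k)
    (hY k).1.process (CondMarkov.generatedFiltration_mono.monotoneOn _) hr
    (fun s t hs hst ht x y => CondMarkov.ae_eq_of_solvesKolmogorov hT.le hPQ (hΨ k)
      (hY k).2.intensity (hkol k) hrk hs hst ht x y
      ((hr.measurable s t hs hst ht x y).mono (𝓕.mono ht) le_rfl)) (hXY0 k)
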